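/- **Setting.** Let $\mathbb T=\mathbb R/\mathbb Z$ with Lebesgue measure, let $c_0>0$, and let $\mathcal M(\mathbb T)$ be the space of finite signed Radon measures on $\mathbb T$ with the total variation norm; $\mathcal M^+(\mathbb T)$ is the set of positive ones. Let $U=L^2_{\mathrm{per},0}(\mathbb T)$ be the Hilbert space of the functions in $L^2(\mathbb T)$ with mean value zero (identified with its dual), and let $$\widetilde V=\{u\in W^{1,2}(\mathbb T):\ \textstyle\int_{\mathbb T}u\,dh=0,\ u_{hh}\in\mathcal M(\mathbb T)\},\qquad \|u\|_{\widetilde V}=\|u_{hh}\|_{\mathcal M(\mathbb T)},$$ derivatives being distributional. For $w\in\widetilde V$ write $w_{hh}=\eta+\nu$ with $\eta\in L^1(\mathbb T)$ the absolutely continuous part and $\nu$ the singular part with respect to Lebesgue measure. Define $\phi,\psi:\widetilde V\to[0,+\infty]$ by $$\phi(w)=\begin{cases}\int_{\mathbb T}\Phi(\eta+c_0)\,dh & \text{if } w_{hh}+c_0\in\mathcal M^+(\mathbb T),\\ +\infty&\text{otherwise,}\end{cases}\qquad \Phi(x)=\begin{cases}\tfrac12x^{-2}&x>0,\\+\infty&x\le0,\end{cases}$$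 and, for a constant $C>0$, $\psi(w)=0$ if $\|w\|_{\widetilde V}\le C$ and $\psi(w)=+\infty$ otherwise. Let $\widetilde B=\partial(\phi+\psi)$, where for $w\in\widetilde V$ $$\widetilde Bw=\{\xi\in\widetilde V':\ (\phi+\psi)(w)+\langle\xi,v-w\rangle\le(\phi+\psi)(v)\ \ \forall v\in\widetilde V\}.$$ Each $u\in U$ is regarded as the element $v\mapsto\langle u,v\rangle_U$ of $\widetilde V'$. Let $B$ be the restriction of $\widetilde B$ to $U$: $Bw=\widetilde Bw\cap U$ for $w\in\widetilde V$, and $Bw=\emptyset$ for $w\in U\setminus\widetilde V$, with $D(B)=\{w\in U:\ Bw\ne\emptyset\}$. For $T>0$, functions in $W^{1,\infty}([0,T];U)$ are identified with their continuous representatives. By $w\in L^\infty([0,T];\widetilde V)$ we mean that $w(t)\in\widetilde V$ for a.e. $t$, that $\|w(t)\|_{\widetilde V}$ is essentially bounded, and that $t\mapsto\int_{\mathbb T}f\,dw_{hh}(t)$ is measurable for every $f\in C(\mathbb T)$. A *variational inequality solution* of $w_t=[(w_{hh}+c_0)^{-3}]_{hh}$ on $[0,T]$ is a function $w\in L^\infty([0,T];\widetilde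 V)\cap C^0([0,T];U)$ with $w_t\in L^\infty([0,T];U)$ such that, for a.e. $t\in[0,T]$, $(\phi+\psi)(w(t))<+\infty$ and $$\langle w_t(t),v-w(t)\rangle_U+(\phi+\psi)(v)-(\phi+\psi)(w(t))\ge0\qquad\text{for all }v\in\widetilde V.$$ **Theorem.** Let $c_0>0$, $C>0$, $T>0$ and $w^0\in D(B)$. (i) There is a unique function $w\in W^{1,\infty}([0,T];U)$ such that $$-w_t(t)\in Bw(t)\quad\text{for a.e. }t\in[0,T],\qquad w(0)=w^0.$$ (ii) This $w$ is also a variational inequality solution of $w_t=[(w_{hh}+c_0)^{-3}]_{hh}$ on $[0,T]$. Moreover $w_{hh}(t)+c_0\in\mathcal M^+(\mathbb T)$ for a.e. $t\in[0,T]$, and the densities $\eta(t)$ of the absolutely continuous parts of $w_{hh}(t)$ have a jointly measurable version $\eta(t,h)$, which satisfies $\eta(t,h)+c_0>0$ for a.e. $(t,h)\in[0,T]\times\mathbb T$. -/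

import Mathlib

open MeasureTheory Set
open scoped ENNReal ContDiff

noncomputable section

namespace ThinFilm

/-- The torus `𝕋 = ℝ/ℤ`; its Lebesgue measure `volume` has total mass one. -/
abbrev Torus : Type := UnitAddCircle

/-! ### Calculus on the torus -/

/-- `f ∈ C^∞(𝕋)`: the associated `1`-periodic function on `ℝ` is smooth. -/
def SmoothOnTorus (f : Torus → ℝ) : Prop := ContDiff ℝ ∞ (fun s : ℝ => f (s : Torus))

/-- The classical derivative `f_h` of a function on the torus. -/
def dh (f : Torus → ℝ) (x : Torus) : ℝ := deriv (fun s : ℝ => f (x + (s : Torus))) 0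

/-- `L²(𝕋)`. -/
abbrev L2Torus : Type := Lp ℝ 2 (volume : Measure Torus)

/-- `U = L²_{per,0}(𝕋)`: the mean-zero functions of `L²(𝕋)`, with the `L²` inner product. -/
def USpace : Submodule ℝ L2Torus where
  carrier := {u | ∫ x, u x = 0}
  zero_mem' := by
    have h : ∫ x, (0 : L2Torus) x = ∫ _ : Torus, (0 : ℝ) :=
      integral_congr_ae (Lp.coeFn_zero ℝ 2 (volume : Measure Torus))
    exact h.trans (integral_zero _ _)
  add_mem' := by
    intro a b ha hb
    have hai := (Lp.memLp a).integrable (by norm_num)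
    have hbi := (Lp.memLp b).integrable (by norm_num)
    simp only [mem_ofPred_eq] at ha hb ⊢
    rw [integral_congr_ae (Lp.coeFn_add a b)]
    simp only [Pi.add_apply]
    rw [integral_add hai hbi, ha, hb, add_zero]
  smul_mem' := by
    intro c a ha
    simp only [mem_ofPred_eq] at ha ⊢
    rw [integral_congr_ae (Lp.coeFn_smul c a)]
    simp only [Pi.smul_apply]
    rw [integral_smul, ha, smul_zero]

/-- `U` is a Hilbert space. -/
instance : CompleteSpace USpace := by
  have h : IsClosed ((USpace : Submodule ℝ L2Torus) : Set L2Torus) := by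
    have he : ((USpace : Submodule ℝ L2Torus) : Set L2Torus) =
        {u | inner ℝ (indicatorConstLp 2 MeasurableSet.univ
          (measure_ne_top (volume : Measure Torus) univ) (1 : ℝ)) u = 0} := by
      ext u
      rw [mem_ofPred_eq, L2.inner_indicatorConstLp_one, Measure.restrict_univ]
      rfl
    rw [he]
    exact isClosed_eq (by fun_prop) continuous_const
  exact h.completeSpace_coe

/-- `u ∈ W^{1,2}(𝕋)`: the distributional derivative of `u` is an `L²` function. -/
def MemW12 (u : L2Torus) : Prop :=
  ∃ u' : L2Torus, ∀ f : Torus → ℝ, SmoothOnTorus f →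
    ∫ x, u x * dh f x = -∫ x, u' x * f x

/-- The second distributional derivative of `u` is the (finite, signed Radon) measure `μ`. -/
def IsSecondDeriv (u : L2Torus) (μ : SignedMeasure Torus) : Prop :=
  ∀ f : Torus → ℝ, SmoothOnTorus f →
    ∫ x, u x * dh (dh f) x = ∫ᵛ x, f x ∂<•μ

/-! ### Facts showing that `Ṽ` is a linear space -/

theorem SmoothOnTorus.continuous {f : Torus → ℝ} (hf : SmoothOnTorus f) : Continuous f :=
  (QuotientAddGroup.isQuotientMap_mk (N := AddSubgroup.zmultiples (1 : ℝ))).continuous_iff.2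
    (ContDiff.continuous hf)

theorem dh_coe (f : Torus → ℝ) (t : ℝ) :
    dh f (t : Torus) = deriv (fun s : ℝ => f (s : Torus)) t := by
  have h := deriv_comp_const_add (fun s : ℝ => f (s : Torus)) t 0
  simpa [dh, AddCircle.coe_add] using h

theorem SmoothOnTorus.dh {f : Torus → ℝ} (hf : SmoothOnTorus f) : SmoothOnTorus (dh f) := by
  unfold SmoothOnTorus
  simp only [dh_coe]
  exact (contDiff_infty_iff_deriv.1 hf).2

theorem SmoothOnTorus.memLp {f : Torus → ℝ} (hf : SmoothOnTorus f) :
    MemLp f 2 (volume : Measure Torus) :=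
  hf.continuous.memLp_of_hasCompactSupport (HasCompactSupport.of_compactSpace f)

theorem SmoothOnTorus.integrable_mul {f : Torus → ℝ} (hf : SmoothOnTorus f) (u : L2Torus) :
    Integrable (fun x => u x * f x) (volume : Measure Torus) :=
  (Lp.memLp u).integrable_mul hf.memLp

theorem SmoothOnTorus.integrable_signed {f : Torus → ℝ} (hf : SmoothOnTorus f)
    (μ : SignedMeasure Torus) : μ.Integrable f := by
  unfold VectorMeasure.Integrable
  rw [← SignedMeasure.totalVariation_eq_variation]
  exact hf.continuous.integrable_of_hasCompactSupport (HasCompactSupport.of_compactSpace f)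

theorem integral_lp_add_mul {g : Torus → ℝ} (hg : SmoothOnTorus g) (a b : L2Torus) :
    ∫ x, (a + b) x * g x = (∫ x, a x * g x) + ∫ x, b x * g x := by
  rw [← integral_add (hg.integrable_mul a) (hg.integrable_mul b)]
  refine integral_congr_ae ?_
  filter_upwards [Lp.coeFn_add a b] with x hx
  rw [hx, Pi.add_apply, add_mul]

theorem integral_lp_smul_mul (g : Torus → ℝ) (c : ℝ) (a : L2Torus) :
    ∫ x, (c • a) x * g x = c * ∫ x, a x * g x := by
  rw [← integral_const_mul]
  refine integral_congr_ae ?_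
  filter_upwards [Lp.coeFn_smul c a] with x hx
  rw [hx, Pi.smul_apply, smul_eq_mul, mul_assoc]

theorem MemW12.add {a b : L2Torus} (ha : MemW12 a) (hb : MemW12 b) : MemW12 (a + b) := by
  obtain ⟨a', ha⟩ := ha
  obtain ⟨b', hb⟩ := hb
  refine ⟨a' + b', fun f hf => ?_⟩
  rw [integral_lp_add_mul hf.dh, integral_lp_add_mul hf, ha f hf, hb f hf, neg_add]

theorem MemW12.smul {a : L2Torus} (c : ℝ) (ha : MemW12 a) : MemW12 (c • a) := by
  obtain ⟨a', ha⟩ := ha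
  refine ⟨c • a', fun f hf => ?_⟩
  rw [integral_lp_smul_mul, integral_lp_smul_mul, ha f hf, mul_neg]

theorem IsSecondDeriv.add {a b : L2Torus} {μ ν : SignedMeasure Torus}
    (ha : IsSecondDeriv a μ) (hb : IsSecondDeriv b ν) : IsSecondDeriv (a + b) (μ + ν) := by
  intro f hf
  rw [integral_lp_add_mul hf.dh.dh, ha f hf, hb f hf,
    VectorMeasure.integral_add_vectorMeasure (hf.integrable_signed μ) (hf.integrable_signed ν)]

theorem IsSecondDeriv.smul {a : L2Torus} {μ : SignedMeasure Torus} (c : ℝ)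
    (ha : IsSecondDeriv a μ) : IsSecondDeriv (c • a) (c • μ) := by
  intro f hf
  rw [integral_lp_smul_mul, ha f hf, VectorMeasure.integral_smul_vectorMeasure, smul_eq_mul]

/-! ### The space `Ṽ` -/

/-- `Ṽ = {u ∈ W^{1,2}_{per,0}(𝕋) : u_hh ∈ 𝓜(𝕋)}`, as a linear subspace of `U`. -/
def VTilde : Submodule ℝ USpace where
  carrier := {u | MemW12 (u : L2Torus) ∧ ∃ μ, IsSecondDeriv (u : L2Torus) μ}
  zero_mem' := by
    have h0 : ((0 : USpace) : L2Torus) = (0 : ℝ) • (0 : L2Torus) := by simp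
    constructor
    · refine ⟨0, fun f _ => ?_⟩
      rw [h0, integral_lp_smul_mul, zero_mul, ← zero_smul ℝ (0 : L2Torus),
        integral_lp_smul_mul, zero_mul, neg_zero]
    · refine ⟨0, fun f _ => ?_⟩
      rw [h0, integral_lp_smul_mul, zero_mul, VectorMeasure.integral_zero_vectorMeasure]
  add_mem' := by
    rintro a b ⟨ha, μ, hμ⟩ ⟨hb, ν, hν⟩
    exact ⟨ha.add hb, μ + ν, hμ.add hν⟩
  smul_mem' := by
    rintro c a ⟨ha, μ, hμ⟩
    exact ⟨ha.smul c, c • μ, hμ.smul c⟩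

open Classical in
/-- The measure `u_hh`, the (unique) second distributional derivative of `u`, for `u ∈ Ṽ`
(and `0` if the second distributional derivative of `u ∈ U` is not a measure). -/
def hh (u : USpace) : SignedMeasure Torus :=
  if h : ∃ μ, IsSecondDeriv (u : L2Torus) μ then h.choose else 0

theorem hh_spec {u : USpace} (hu : u ∈ VTilde) : IsSecondDeriv (u : L2Torus) (hh u) := by
  have h : ∃ μ, IsSecondDeriv (u : L2Torus) μ := hu.2
  rw [hh, dif_pos h]
  exact h.choose_spec

/-- `‖w‖_Ṽ = ‖w_hh‖_{𝓜(𝕋)}`, the total variation of `w_hh`. -/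
def normV (w : USpace) : ℝ := (hh w).totalVariation.real univ

/-- The Lebesgue density `η ∈ L¹(𝕋)` of the absolutely continuous part of `w_hh`. -/
def acDensity (w : USpace) : Torus → ℝ := (hh w).rnDeriv volume

/-- `w_hh + c₀` is a positive measure. -/
def PosMeasure (c₀ : ℝ) (w : USpace) : Prop :=
  0 ≤ hh w + c₀ • (volume : Measure Torus).toSignedMeasure

/-! ### The functionals `φ` and `ψ` -/

/-- `Φ(x) = x⁻²/2` for `x > 0` and `Φ(x) = +∞` for `x ≤ 0`. -/
def Phi (x : ℝ) : ℝ≥0∞ := if x ≤ 0 then ⊤ else ENNReal.ofReal ((x ^ 2)⁻¹ / 2)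

open Classical in
/-- `φ(w) = ∫ Φ(η + c₀)` if `w_hh + c₀` is a positive measure, and `+∞` otherwise. -/
def phi (c₀ : ℝ) (w : VTilde) : ℝ≥0∞ :=
  if PosMeasure c₀ w then ∫⁻ x, Phi (acDensity w x + c₀) else ⊤

open Classical in
/-- The indicator functional of the ball of radius `C` in `Ṽ`. -/
def psi (C : ℝ) (w : VTilde) : ℝ≥0∞ := if normV w ≤ C then 0 else ⊤

/-- `φ + ψ : Ṽ → ℝ ∪ {+∞}`. -/
def energy (c₀ C : ℝ) (w : VTilde) : EReal := ((phi c₀ w + psi C w : ℝ≥0∞) : EReal)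

/-! ### Subdifferentials and the operator `B` -/

/-- The subdifferential at `x` of a functional `f` on a real vector space `X` with norm `N`:
the set of the `N`-bounded linear functionals `ξ` such that `f x + ⟨ξ, y - x⟩ ≤ f y` for
every `y`. -/
def subdifferential {X : Type*} [AddCommGroup X] [Module ℝ X] (N : X → ℝ) (f : X → EReal)
    (x : X) : Set (X →ₗ[ℝ] ℝ) :=
  {ξ | (∃ K : ℝ, ∀ v, |ξ v| ≤ K * N v) ∧ ∀ y, f x + (ξ (y - x) : EReal) ≤ f y}

/-- `B̃ = ∂(φ + ψ) : Ṽ → Ṽ'`. -/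
def BTilde (c₀ C : ℝ) (w : VTilde) : Set (VTilde →ₗ[ℝ] ℝ) :=
  subdifferential (fun v : VTilde => normV v) (energy c₀ C) w

/-- The inclusion of `U` (identified with `U'`) in `Ṽ'`: `u` acts on `Ṽ` as `v ↦ ⟨u, v⟩_U`. -/
def toDual (u : USpace) : VTilde →ₗ[ℝ] ℝ :=
  (innerSL ℝ u : USpace →ₗ[ℝ] ℝ) ∘ₗ VTilde.subtype

/-- The multivalued operator `B` on `U`, the restriction of `B̃` to `U`: `u ∈ B w` if and only if
`w ∈ Ṽ` and `u`, as a functional on `Ṽ`, belongs to `B̃ w`. -/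
def B (c₀ C : ℝ) (w : USpace) : Set USpace :=
  {u | ∃ hw : w ∈ VTilde, toDual u ∈ BTilde c₀ C ⟨w, hw⟩}

/-- `D(B)`. -/
def domB (c₀ C : ℝ) : Set USpace := {w | (B c₀ C w).Nonempty}

/-! ### Functions of time -/

/-- `w ∈ W^{1,∞}([0,T];U)` with weak time derivative `w_t = w'`; `w` is the continuous
representative. -/
structure MemW1Inf (T : ℝ) (w w' : ℝ → USpace) : Prop where
  continuousOn : ContinuousOn w (Icc 0 T)
  memLp : MemLp w ⊤ (volume.restrict (Icc 0 T))
  memLp_deriv : MemLp w' ⊤ (volume.restrict (Icc 0 T))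
  weak_deriv : ∀ θ : ℝ → ℝ, ContDiff ℝ ∞ θ → HasCompactSupport θ → tsupport θ ⊆ Ioo 0 T →
    ∫ t in Icc 0 T, deriv θ t • w t = -∫ t in Icc 0 T, θ t • w' t

/-- `w ∈ L^∞([0,T];Ṽ)`: `w(t)` lies in a fixed ball of `Ṽ` for a.e. `t`, and `t ↦ w_hh(t)` is
weakly-* measurable. -/
structure MemLInfV (T : ℝ) (w : ℝ → USpace) : Prop where
  mem : ∀ᵐ t ∂(volume.restrict (Icc 0 T)), w t ∈ VTilde
  bounded : ∃ K : ℝ, ∀ᵐ t ∂(volume.restrict (Icc 0 T)), normV (w t) ≤ K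
  measurable : ∀ f : C(Torus, ℝ),
    AEMeasurable (fun t => ∫ᵛ x, f x ∂<•(hh (w t))) (volume.restrict (Icc 0 T))

/-- `w` is a strong solution, on `[0,T]`, of the Cauchy problem `-w_t ∈ B w`, `w(0) = w⁰`, in
`W^{1,∞}([0,T];U)`, with `w_t = w'`. -/
structure IsCauchySolution (c₀ C T : ℝ) (w₀ : USpace) (w w' : ℝ → USpace) : Prop where
  memW1Inf : MemW1Inf T w w'
  inclusion : ∀ᵐ t ∂(volume.restrict (Icc 0 T)), -w' t ∈ B c₀ C (w t)
  initial : w 0 = w₀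

/-- `w`, with `w_t = w'`, is a variational inequality solution on `[0,T]` of
`w_t = [(w_hh + c₀)⁻³]_hh`: `w ∈ L^∞([0,T];Ṽ) ∩ C⁰([0,T];U)`, `w_t ∈ L^∞([0,T];U)`, and
`⟨w_t, v - w⟩ + (φ+ψ)(v) - (φ+ψ)(w) ≥ 0` for a.e. `t` and all `v ∈ Ṽ`. -/
structure IsVISolution (c₀ C T : ℝ) (w w' : ℝ → USpace) : Prop where
  memW1Inf : MemW1Inf T w w'
  memLInfV : MemLInfV T w
  ineq : ∀ᵐ t ∂(volume.restrict (Icc 0 T)), ∃ hw : w t ∈ VTilde, ∀ v : VTilde,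
    energy c₀ C ⟨w t, hw⟩ ≤ ((inner ℝ (w' t) ((v : USpace) - w t) : ℝ) : EReal) + energy c₀ C v

/-- The two positivity properties, on `[0,T]`: `w_hh(t) + c₀` is a positive measure for a.e. `t`,
and `η + c₀ > 0` for a.e. `(t,h)`, where `η` is a (jointly measurable) function on `[0,T] × 𝕋`
whose slice `η(t,·)` is the density of the absolutely continuous part of `w_hh(t)` for a.e. `t`. -/
structure IsPositive (c₀ T : ℝ) (w : ℝ → USpace) : Prop where
  mem : ∀ᵐ t ∂(volume.restrict (Icc 0 T)), w t ∈ VTilde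
  measure : ∀ᵐ t ∂(volume.restrict (Icc 0 T)), PosMeasure c₀ (w t)
  density : ∃ η : ℝ → Torus → ℝ,
    AEStronglyMeasurable (Function.uncurry η)
      ((volume.restrict (Icc 0 T)).prod (volume : Measure Torus)) ∧
    (∀ᵐ t ∂(volume.restrict (Icc 0 T)), η t =ᵐ[(volume : Measure Torus)] acDensity (w t)) ∧
    ∀ᵐ p ∂((volume.restrict (Icc 0 T)).prod (volume : Measure Torus)), 0 < η p.1 p.2 + c₀

end ThinFilm

end

/-! The inclusion is the gradient flow, in the Hilbert space U, of φ + ψ extended by +∞ outside Ṽ.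
Since Ṽ is not reflexive, nothing is minimised in Ṽ itself. It is enough that the functional on U is
nonnegative, convex and has sublevel sets closed in U.

Convexity and closedness come from a dual description of the sublevel sets (`mem_sublevel_iff`). If
w_hh + c₀ is a positive measure μ, testing with the constant 1 shows that μ has mass c₀. The bound
‖w‖ ≤ C is a family of inequalities against continuous functions (`totalVariation_le_iff`). Since
Φ(x) is the supremum over b ≥ 0 of 3b²/2 - b³x, the bound φ(w) ≤ K is also such a family
(`lintegral_Phi_le_iff`); the singular part of μ does not matter, because test functions can be
concentrated away from it. All conditions are affine in the pair (w, μ), which gives convexity. Weak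
compactness of the positive measures of mass c₀ gives closedness (`isClosed_sublevel`). The Poincaré
inequality makes every element of U a bounded functional on Ṽ, so B is exactly the subdifferential
in U (`mem_B_iff`).

For existence (`exists_gradientFlow`), implicit Euler steps are solved by proximal minimisation. As
w⁰ ∈ D(B), the discrete velocities are bounded by the norm of one initial subgradient. Comparing
steps τ and τ/2 gives an error of order √τ, so the dyadic schemes converge to a Lipschitz curve. The
discrete evolution variational inequality passes to the limit by lower semicontinuity. A Lipschitz
curve in a separable Hilbert space is differentiable almost everywhere, and there the inequality
becomes -w_t ∈ Bw.

For uniqueness, a weak derivative is shown to be an almost everywhere derivative, and monotonicity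
makes ‖v - w‖² nonincreasing. The variational inequality is the subgradient inequality rearranged.
Positivity holds because w(t) stays in the effective domain and Φ = +∞ on x ≤ 0; the jointly
measurable density is a Radon–Nikodym derivative of kernels. -/

namespace ThinFilm

/-! ### Proximal steps and estimates for the implicit Euler scheme. -/

section GradientFlow

open Filter Topology
open scoped RealInnerProductSpace

variable {H : Type*} [NormedAddCommGroup H] [InnerProductSpace ℝ H]

/-- `ξ` is a subgradient at `x` of the functional equal to `e` on `D` and to `+∞` off `D`. -/
def IsSubgradient (D : Set H) (e : H → ℝ) (x ξ : H) : Prop :=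
  x ∈ D ∧ ∀ y ∈ D, e x + ⟪ξ, y - x⟫ ≤ e y

/-- Testing each subgradient inequality with the other point and adding cancels the energies. The
velocity bound, the comparison of step sizes and uniqueness all rest on this. -/
theorem IsSubgradient.monotone {D : Set H} {e : H → ℝ} {x y ξ ζ : H}
    (hx : IsSubgradient D e x ξ) (hy : IsSubgradient D e y ζ) : 0 ≤ ⟪ξ - ζ, x - y⟫ := by
  have h1 := hx.2 y hy.1
  have h2 := hy.2 x hx.1
  have h3 : ⟪ξ, y - x⟫ = -⟪ξ, x - y⟫ := by rw [← inner_neg_right, neg_sub]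
  rw [inner_sub_left]
  linarith

omit [InnerProductSpace ℝ H] in
/-- Sequential lower semicontinuity from closed sublevel sets. -/
theorem mem_and_le_of_tendsto {D : Set H} {e : H → ℝ}
    (hcl : ∀ K, IsClosed {x | x ∈ D ∧ e x ≤ K}) {u : ℕ → H} {x : H} {k : ℕ → ℝ} {K : ℝ}
    (hu : Tendsto u atTop (𝓝 x)) (hD : ∀ᶠ n in atTop, u n ∈ D) (hk : ∀ᶠ n in atTop, e (u n) ≤ k n)
    (hK : Tendsto k atTop (𝓝 K)) : x ∈ D ∧ e x ≤ K := by
  have key : ∀ ε > 0, x ∈ D ∧ e x ≤ K + ε := by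
    intro ε hε
    refine (hcl (K + ε)).mem_of_tendsto hu ?_
    filter_upwards [hD, hk, hK.eventually_le_const (lt_add_of_pos_right K hε)] with n h1 h2 h3
    exact ⟨h1, h2.trans h3⟩
  exact ⟨(key 1 one_pos).1, le_of_forall_pos_le_add fun ε hε => (key ε hε).2⟩

/-- The proximal step `x + τ ∂e(x) ∋ f` is solvable. -/
theorem exists_isSubgradient_resolvent [CompleteSpace H] {D : Set H} {e : H → ℝ}
    (hconv : ConvexOn ℝ D e)
    (hcl : ∀ K, IsClosed {x | x ∈ D ∧ e x ≤ K}) (hpos : ∀ x ∈ D, 0 ≤ e x) (hne : D.Nonempty)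
    {τ : ℝ} (hτ : 0 < τ) (f : H) : ∃ x, IsSubgradient D e x (τ⁻¹ • (f - x)) := by
  set F : H → ℝ := fun x => e x + (2 * τ)⁻¹ * ‖x - f‖ ^ 2 with hF
  have hbdd : BddBelow (F '' D) := ⟨0, by
    rintro _ ⟨x, hx, rfl⟩
    exact add_nonneg (hpos x hx) (by positivity)⟩
  set m := sInf (F '' D) with hm
  have hmle : ∀ x ∈ D, m ≤ F x := fun x hx => csInf_le hbdd ⟨x, hx, rfl⟩
  have hex : ∀ n : ℕ, ∃ x ∈ D, F x ≤ m + 1 / ((n : ℝ) + 1) := by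
    intro n
    have h1 : m < m + 1 / ((n : ℝ) + 1) := lt_add_of_pos_right _ (by positivity)
    obtain ⟨_, ⟨x, hx, rfl⟩, h⟩ := exists_lt_of_csInf_lt (hne.image F) h1
    exact ⟨x, hx, h.le⟩
  choose x hxD hxm using hex
  -- The midpoint of a and b competes in the minimisation, and the parallelogram law turns the
  -- quadratic term into a uniform convexity gap. Minimising sequences are therefore Cauchy, without
  -- weak compactness.
  have hmid : ∀ a ∈ D, ∀ b ∈ D, ‖a - b‖ ^ 2 ≤ 4 * τ * (F a + F b - 2 * m) := by
    intro a ha b hb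
    have hc : (1 / 2 : ℝ) • a + (1 / 2 : ℝ) • b ∈ D :=
      hconv.1 ha hb (by norm_num) (by norm_num) (by norm_num)
    have h1 := hmle _ hc
    have h2 := hconv.2 ha hb (by norm_num : (0 : ℝ) ≤ 1 / 2) (by norm_num : (0 : ℝ) ≤ 1 / 2)
      (by norm_num)
    have h3 : (1 / 2 : ℝ) • a + (1 / 2 : ℝ) • b - f = (1 / 2 : ℝ) • ((a - f) + (b - f)) := by
      module
    have h4 := parallelogram_law_with_norm ℝ (a - f) (b - f)
    rw [sub_sub_sub_cancel_right] at h4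
    simp only [hF, smul_eq_mul] at h1 h2 ⊢
    rw [h3, norm_smul, mul_pow] at h1
    have h5 : ‖(1 / 2 : ℝ)‖ ^ 2 = 1 / 4 := by norm_num
    rw [h5] at h1
    have h6 : ‖a - f + (b - f)‖ ^ 2 = 2 * (‖a - f‖ ^ 2 + ‖b - f‖ ^ 2) - ‖a - b‖ ^ 2 := by
      nlinarith
    rw [h6] at h1
    have h7 : (2 * τ)⁻¹ * ‖a - b‖ ^ 2 ≤
        2 * (e a + (2 * τ)⁻¹ * ‖a - f‖ ^ 2 + (e b + (2 * τ)⁻¹ * ‖b - f‖ ^ 2) - 2 * m) := by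
      nlinarith
    have h8 : ‖a - b‖ ^ 2 = (2 * τ) * ((2 * τ)⁻¹ * ‖a - b‖ ^ 2) := by field_simp
    rw [h8]
    calc _ ≤ (2 * τ) * _ := mul_le_mul_of_nonneg_left h7 (by positivity)
      _ = _ := by ring
  have hcau : CauchySeq x := by
    rw [Metric.cauchySeq_iff']
    intro ε hε
    obtain ⟨N, hN⟩ := exists_nat_one_div_lt (show 0 < ε ^ 2 / (8 * τ) by positivity)
    refine ⟨N, fun n hn => ?_⟩
    have h1 := hmid (x n) (hxD n) (x N) (hxD N)
    have h2 : 1 / ((n : ℝ) + 1) ≤ 1 / ((N : ℝ) + 1) := by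
      apply one_div_le_one_div_of_le (by positivity)
      have : (N : ℝ) ≤ n := by exact_mod_cast hn
      linarith
    have h3 : F (x n) + F (x N) - 2 * m < 2 * (ε ^ 2 / (8 * τ)) := by
      linarith [hxm n, hxm N]
    have h4 : ‖x n - x N‖ ^ 2 < ε ^ 2 := by
      calc _ ≤ _ := h1
        _ < 4 * τ * (2 * (ε ^ 2 / (8 * τ))) := mul_lt_mul_of_pos_left h3 (by positivity)
        _ = ε ^ 2 := by field_simp; norm_num
    rw [dist_eq_norm]
    exact lt_of_pow_lt_pow_left₀ 2 hε.le h4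
  obtain ⟨z, hz⟩ := cauchySeq_tendsto_of_complete hcau
  have hlim : Tendsto (fun n : ℕ => m + 1 / ((n : ℝ) + 1) - (2 * τ)⁻¹ * ‖x n - f‖ ^ 2) atTop
      (𝓝 (m + 0 - (2 * τ)⁻¹ * ‖z - f‖ ^ 2)) :=
    (tendsto_const_nhds.add tendsto_one_div_add_atTop_nhds_zero_nat).sub
      (((hz.sub_const f).norm.pow 2).const_mul _)
  obtain ⟨hzD, hze⟩ := mem_and_le_of_tendsto hcl hz (Eventually.of_forall hxD)
    (Eventually.of_forall fun n => by have := hxm n; simp only [hF] at this; linarith) hlim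
  have hzm : F z ≤ m := by simp only [hF]; linarith
  refine ⟨z, hzD, fun y hy => ?_⟩
  -- The minimiser z is compared with points of the segment towards y. After division by s the
  -- first-order terms form the subgradient inequality, and the quadratic remainder vanishes as s →
  -- 0.
  have hs : ∀ s ∈ Ioo (0 : ℝ) 1,
      e z + ⟪τ⁻¹ • (f - z), y - z⟫ ≤ e y + s * ((2 * τ)⁻¹ * ‖y - z‖ ^ 2) := by
    intro s hs
    have hc : (1 - s) • z + s • y ∈ D := hconv.1 hzD hy (by linarith [hs.2]) hs.1.le (by ring)
    have h1 := hzm.trans (hmle _ hc)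
    have h2 := hconv.2 hzD hy (by linarith [hs.2] : 0 ≤ 1 - s) hs.1.le (by ring)
    have h3 : (1 - s) • z + s • y - f = (z - f) + s • (y - z) := by module
    simp only [hF, smul_eq_mul] at h1 h2
    rw [h3, norm_add_sq_real, norm_smul, mul_pow, inner_smul_right, Real.norm_eq_abs, sq_abs] at h1
    have h4 : ⟪τ⁻¹ • (f - z), y - z⟫ = -(2 * τ)⁻¹ * (2 * ⟪z - f, y - z⟫) := by
      rw [real_inner_smul_left, ← neg_sub z f, inner_neg_left]
      field_simp
    rw [h4]
    have h5 : s * (e z + -(2 * τ)⁻¹ * (2 * ⟪z - f, y - z⟫)) ≤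
        s * (e y + s * ((2 * τ)⁻¹ * ‖y - z‖ ^ 2)) := by nlinarith
    exact le_of_mul_le_mul_left h5 hs.1
  have hl : Tendsto (fun s : ℝ => e y + s * ((2 * τ)⁻¹ * ‖y - z‖ ^ 2)) (𝓝[>] 0)
      (𝓝 (e y + 0 * ((2 * τ)⁻¹ * ‖y - z‖ ^ 2))) := by
    apply Tendsto.mono_left _ nhdsWithin_le_nhds
    exact (continuous_const.add (continuous_id.mul continuous_const)).tendsto 0
  rw [zero_mul, add_zero] at hl
  refine ge_of_tendsto hl ?_
  filter_upwards [Ioo_mem_nhdsGT (show (0 : ℝ) < 1 by norm_num)] with s h using hs s h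

/-- `u` solves the implicit Euler scheme with step `τ`, with subgradients `ξ`. -/
structure IsEuler (D : Set H) (e : H → ℝ) (τ : ℝ) (u ξ : ℕ → H) : Prop where
  subgrad : ∀ k, IsSubgradient D e (u k) (ξ k)
  step : ∀ k, u (k + 1) = u k - τ • ξ (k + 1)

theorem exists_isEuler [CompleteSpace H] {D : Set H} {e : H → ℝ} (hconv : ConvexOn ℝ D e)
    (hcl : ∀ K, IsClosed {x | x ∈ D ∧ e x ≤ K}) (hpos : ∀ x ∈ D, 0 ≤ e x)
    {τ : ℝ} (hτ : 0 < τ) {x₀ ξ₀ : H} (h₀ : IsSubgradient D e x₀ ξ₀) :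
    ∃ u ξ : ℕ → H, IsEuler D e τ u ξ ∧ u 0 = x₀ ∧ ξ 0 = ξ₀ := by
  choose J hJ using exists_isSubgradient_resolvent hconv hcl hpos ⟨x₀, h₀.1⟩ hτ
  let u : ℕ → H := fun n => J^[n] x₀
  have hu : ∀ k, u (k + 1) = J (u k) := fun k => Function.iterate_succ_apply' J k x₀
  -- Index 0 carries the given subgradient, which no Euler step produces; it is what the later
  -- velocities are compared with.
  let ξ : ℕ → H := fun n => Nat.casesOn n ξ₀ fun k => τ⁻¹ • (u k - J (u k))
  refine ⟨u, ξ, ⟨fun k => ?_, fun k => ?_⟩, rfl, rfl⟩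
  · cases k with
    | zero => exact h₀
    | succ k => rw [hu]; exact hJ (u k)
  · change u (k + 1) = u k - τ • (τ⁻¹ • (u k - J (u k)))
    rw [hu, smul_inv_smul₀ hτ.ne', sub_sub_cancel]

namespace IsEuler

variable {D : Set H} {e : H → ℝ} {τ : ℝ} {u ξ : ℕ → H}

/-- Monotonicity at consecutive points, which differ by τ • ξ (k + 1), gives ‖ξ (k + 1)‖² ≤ ⟪ξ k, ξ
(k + 1)⟫. Iterated, it bounds every velocity by ‖ξ 0‖, independently of τ. -/
theorem norm_succ_le (h : IsEuler D e τ u ξ) (hτ : 0 < τ) (k : ℕ) : ‖ξ (k + 1)‖ ≤ ‖ξ k‖ := by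
  have h1 := (h.subgrad (k + 1)).monotone (h.subgrad k)
  rw [h.step k, sub_sub_cancel_left, inner_neg_right, inner_smul_right, inner_sub_left,
    real_inner_self_eq_norm_sq] at h1
  have h2 : ‖ξ (k + 1)‖ ^ 2 ≤ ⟪ξ k, ξ (k + 1)⟫ := by
    by_contra hc
    push Not at hc
    nlinarith
  have h3 := real_inner_le_norm (ξ k) (ξ (k + 1))
  by_contra hc
  push Not at hc
  nlinarith [norm_nonneg (ξ k)]

theorem norm_le (h : IsEuler D e τ u ξ) (hτ : 0 < τ) (k : ℕ) : ‖ξ k‖ ≤ ‖ξ 0‖ := by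
  induction k with
  | zero => exact le_rfl
  | succ k ih => exact (h.norm_succ_le hτ k).trans ih

theorem norm_sub_succ_le (h : IsEuler D e τ u ξ) (hτ : 0 < τ) (k : ℕ) :
    ‖u (k + 1) - u k‖ ≤ τ * ‖ξ 0‖ := by
  rw [h.step k, sub_sub_cancel_left, norm_neg, norm_smul, Real.norm_of_nonneg hτ.le]
  exact mul_le_mul_of_nonneg_left (h.norm_le hτ _) hτ.le

theorem norm_add_sub_le (h : IsEuler D e τ u ξ) (hτ : 0 < τ) (j i : ℕ) :
    ‖u (j + i) - u j‖ ≤ i * (τ * ‖ξ 0‖) := by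
  induction i with
  | zero => simp
  | succ i ih =>
    have h1 := norm_sub_le_norm_sub_add_norm_sub (u (j + (i + 1))) (u (j + i)) (u j)
    have h2 := h.norm_sub_succ_le hτ (j + i)
    rw [← add_assoc] at h1 ⊢
    push_cast
    linarith

theorem energy_succ_le (h : IsEuler D e τ u ξ) (hτ : 0 < τ) (k : ℕ) : e (u (k + 1)) ≤ e (u k) := by
  have h1 := (h.subgrad (k + 1)).2 (u k) (h.subgrad k).1
  rw [h.step k, sub_sub_cancel, inner_smul_right, real_inner_self_eq_norm_sq, ← h.step k] at h1
  nlinarith [sq_nonneg ‖ξ (k + 1)‖]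

theorem energy_le (h : IsEuler D e τ u ξ) (hτ : 0 < τ) (k : ℕ) : e (u k) ≤ e (u 0) := by
  induction k with
  | zero => exact le_rfl
  | succ k ih => exact (h.energy_succ_le hτ k).trans ih

/-- The discrete evolution variational inequality. -/
theorem evi (h : IsEuler D e τ u ξ) (hτ : 0 < τ) {v : H} (hv : v ∈ D) (j i : ℕ) :
    ‖u (j + i) - v‖ ^ 2 / 2 - ‖u j - v‖ ^ 2 / 2 ≤ τ * i * (e v - e (u (j + i))) := by
  induction i with
  | zero => simp
  | succ i ih =>
    rw [← add_assoc]
    have h1 := (h.subgrad (j + i + 1)).2 v hv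
    have h2 := h.energy_succ_le hτ (j + i)
    have h3 : ‖u (j + i) - v‖ ^ 2 = ‖u (j + i + 1) - v‖ ^ 2
        + 2 * (τ * ⟪ξ (j + i + 1), u (j + i + 1) - v⟫) + ‖τ • ξ (j + i + 1)‖ ^ 2 := by
      have : u (j + i) - v = (u (j + i + 1) - v) + τ • ξ (j + i + 1) := by
        rw [h.step (j + i)]; abel
      rw [this, norm_add_sq_real, inner_smul_right, real_inner_comm]
    have h4 : ⟪ξ (j + i + 1), v - u (j + i + 1)⟫ = -⟪ξ (j + i + 1), u (j + i + 1) - v⟫ := by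
      rw [← inner_neg_right, neg_sub]
    have h5 : 0 ≤ τ * (i : ℝ) := by positivity
    -- The energy decreases along the scheme, so the first i steps may be charged with the newer,
    -- lower value; only the final energy then remains on the right.
    have h6 : 0 ≤ τ * i * (e (u (j + i)) - e (u (j + i + 1))) := mul_nonneg h5 (by linarith)
    have h7 : 0 ≤ τ * (e v - e (u (j + i + 1)) + ⟪ξ (j + i + 1), u (j + i + 1) - v⟫) :=
      mul_nonneg hτ.le (by linarith)
    push_cast
    nlinarith [sq_nonneg ‖τ • ξ (j + i + 1)‖]

/-- Comparison of the schemes with steps `τ` and `τ / 2`. -/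
theorem norm_sub_half_le (h : IsEuler D e τ u ξ) (hτ : 0 < τ) {y ζ : ℕ → H}
    (hy : IsEuler D e (τ / 2) y ζ) (h0 : u 0 = y 0) {M : ℝ} (hξ : ‖ξ 0‖ ≤ M) (hζ : ‖ζ 0‖ ≤ M)
    (k : ℕ) : ‖u k - y (2 * k)‖ ^ 2 ≤ k * (τ * M) ^ 2 := by
  induction k with
  | zero => simp [h0]
  | succ k ih =>
    have hM : 0 ≤ M := (norm_nonneg _).trans hξ
    have e1 : 2 * (k + 1) = 2 * k + 1 + 1 := by ring
    rw [e1]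
    set d := u (k + 1) - y (2 * k + 1 + 1) with hd
    set a := ξ (k + 1)
    set b := ζ (2 * k + 1)
    set c := ζ (2 * k + 1 + 1)
    have hd0 : u k - y (2 * k) = d + (τ / 2) • ((a - b) + (a - c)) := by
      rw [hd, h.step k, hy.step (2 * k + 1), hy.step (2 * k)]
      module
    have m1 : 0 ≤ ⟪a - c, d⟫ := (h.subgrad _).monotone (hy.subgrad _)
    have m2 : 0 ≤ ⟪a - b, u (k + 1) - y (2 * k + 1)⟫ := (h.subgrad _).monotone (hy.subgrad _)
    -- Monotonicity for a and b holds at the intermediate fine point y (2k + 1), half a step away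
    -- from d. The shift costs τ/2 · ⟪a - b, c⟫ ≥ -τM², hence (τM)² per coarse step.
    have hd2 : d = (u (k + 1) - y (2 * k + 1)) + (τ / 2) • c := by
      rw [hd, hy.step (2 * k + 1)]; module
    have m3 : ⟪a - b, d⟫ = ⟪a - b, u (k + 1) - y (2 * k + 1)⟫ + τ / 2 * ⟪a - b, c⟫ := by
      rw [hd2, inner_add_right, inner_smul_right]
    have na : ‖a‖ ≤ M := (h.norm_le hτ _).trans hξ
    have nb : ‖b‖ ≤ M := (hy.norm_le (by positivity) _).trans hζ
    have nc : ‖c‖ ≤ M := (hy.norm_le (by positivity) _).trans hζ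
    have m4 : -(2 * M * M) ≤ ⟪a - b, c⟫ := by
      have h1 := neg_le_of_abs_le (abs_real_inner_le_norm (a - b) c)
      have h2 : ‖a - b‖ * ‖c‖ ≤ (2 * M) * M :=
        mul_le_mul ((norm_sub_le _ _).trans (by linarith)) nc (norm_nonneg _) (by positivity)
      linarith
    have h5 : ‖u k - y (2 * k)‖ ^ 2 = ‖d‖ ^ 2 + τ * (⟪a - b, d⟫ + ⟪a - c, d⟫)
        + ‖(τ / 2) • ((a - b) + (a - c))‖ ^ 2 := by
      rw [hd0, norm_add_sq_real, inner_smul_right, inner_add_right, real_inner_comm (a - b),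
        real_inner_comm (a - c)]
      ring
    have h6 : -(τ * M ^ 2) ≤ ⟪a - b, d⟫ + ⟪a - c, d⟫ := by nlinarith
    have h7 : τ * -(τ * M ^ 2) ≤ τ * (⟪a - b, d⟫ + ⟪a - c, d⟫) :=
      mul_le_mul_of_nonneg_left h6 hτ.le
    push_cast
    nlinarith [sq_nonneg ‖(τ / 2) • ((a - b) + (a - c))‖]

end IsEuler

end GradientFlow

end ThinFilm

/-! ### Convergence of the dyadic Euler schemes to a gradient flow. -/

namespace ThinFilm

section GradientFlowLimit

open Filter Topology
open scoped RealInnerProductSpace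

variable {H : Type*} [NormedAddCommGroup H] [InnerProductSpace ℝ H]

theorem floor_two_mul_eq (x : ℝ) (hx : 0 ≤ x) :
    ⌊x * 2⌋₊ = 2 * ⌊x⌋₊ ∨ ⌊x * 2⌋₊ = 2 * ⌊x⌋₊ + 1 := by
  have h1 := Nat.floor_le hx
  have h2 := Nat.lt_floor_add_one x
  have h3 : 2 * ⌊x⌋₊ ≤ ⌊x * 2⌋₊ := Nat.le_floor (by push_cast; linarith)
  have h4 : ⌊x * 2⌋₊ < 2 * ⌊x⌋₊ + 2 := by
    rw [Nat.floor_lt (by positivity)]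
    push_cast; linarith
  omega

/-- Existence for the gradient flow of a convex lower semicontinuous functional: a Lipschitz curve
satisfying the evolution variational inequality. -/
theorem exists_gradientFlow [CompleteSpace H] {D : Set H} {e : H → ℝ} (hconv : ConvexOn ℝ D e)
    (hcl : ∀ K, IsClosed {x | x ∈ D ∧ e x ≤ K}) (hpos : ∀ x ∈ D, 0 ≤ e x)
    {x₀ ξ₀ : H} (h₀ : IsSubgradient D e x₀ ξ₀) :
    ∃ w : ℝ → H, w 0 = x₀ ∧ LipschitzWith ‖ξ₀‖₊ w ∧ (∀ t, w t ∈ D) ∧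
      ∀ v ∈ D, ∀ s t, 0 ≤ s → s < t →
        ‖w t - v‖ ^ 2 / 2 - ‖w s - v‖ ^ 2 / 2 ≤ (t - s) * (e v - e (w t)) := by
  set τ : ℕ → ℝ := fun n => (1 / 2 : ℝ) ^ n with hτdef
  have hτ : ∀ n, 0 < τ n := fun n => by positivity
  have hτ1 : ∀ n, τ n ≤ 1 := fun n => pow_le_one₀ (by norm_num) (by norm_num)
  have hτs : ∀ n, τ (n + 1) = τ n / 2 := fun n => by simp only [hτdef, pow_succ]; ring
  have hτ0 : Tendsto τ atTop (𝓝 0) :=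
    tendsto_pow_atTop_nhds_zero_of_lt_one (by norm_num) (by norm_num)
  choose u ξ hu hu0 hξ0 using fun n => exists_isEuler hconv hcl hpos (hτ n) h₀
  set M := ‖ξ₀‖
  have hM : 0 ≤ M := norm_nonneg _
  set N : ℕ → ℝ → ℕ := fun n t => ⌊t / τ n⌋₊ with hN
  have hNle : ∀ n t, 0 ≤ t → τ n * N n t ≤ t := fun n t ht => by
    have := Nat.floor_le (div_nonneg ht (hτ n).le)
    calc τ n * N n t ≤ τ n * (t / τ n) := mul_le_mul_of_nonneg_left this (hτ n).le
      _ = t := by field_simp [(hτ n).ne']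
  have hNlt : ∀ n t, t < τ n * N n t + τ n := fun n t => by
    have := Nat.lt_floor_add_one (t / τ n)
    calc t = τ n * (t / τ n) := by field_simp [(hτ n).ne']
      _ < τ n * (N n t + 1) := mul_lt_mul_of_pos_left this (hτ n)
      _ = _ := by ring
  have hNlim : ∀ t, 0 ≤ t → Tendsto (fun n => τ n * N n t) atTop (𝓝 t) := fun t ht => by
    have : Tendsto (fun n => t - τ n) atTop (𝓝 (t - 0)) := tendsto_const_nhds.sub hτ0
    rw [sub_zero] at this
    exact tendsto_of_tendsto_of_tendsto_of_le_of_le this tendsto_const_nhds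
      (fun n => by linarith [hNlt n t]) (fun n => hNle n t ht)
  set U : ℕ → ℝ → H := fun n t => u n (N n t) with hU
  -- As τ n * N n t ≤ t, the comparison of schemes costs at most M√(t τ n), and rounding t on the
  -- finer grid costs at most one more fine step. With τ n = 2⁻ⁿ the sum is geometric of ratio
  -- √(1/2).
  have hcomp : ∀ n t, 0 ≤ t → dist (U n t) (U (n + 1) t) ≤ (M * √t + M) * (√(1 / 2)) ^ n := by
    intro n t ht
    have hsq : (√(1 / 2)) ^ n = √(τ n) := by
      rw [eq_comm, Real.sqrt_eq_iff_mul_self_eq (hτ n).le (by positivity), ← mul_pow,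
        Real.mul_self_sqrt (by norm_num)]
    have hyE : IsEuler D e (τ n / 2) (u (n + 1)) (ξ (n + 1)) := hτs n ▸ hu (n + 1)
    have h1 := (hu n).norm_sub_half_le (hτ n) hyE (by rw [hu0, hu0]) (M := M) (by rw [hξ0])
      (by rw [hξ0]) (N n t)
    have h2 : ‖u n (N n t) - u (n + 1) (2 * N n t)‖ ≤ M * √t * √(τ n) := by
      rw [mul_assoc, ← Real.sqrt_mul ht]
      refine le_of_sq_le_sq ?_ (by positivity)
      rw [mul_pow, Real.sq_sqrt (mul_nonneg ht (hτ n).le)]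
      refine h1.trans ?_
      have := mul_le_mul_of_nonneg_right (hNle n t ht) (show 0 ≤ τ n * M ^ 2 by
        have := hτ n; positivity)
      nlinarith
    have h3 : ‖u (n + 1) (2 * N n t) - U (n + 1) t‖ ≤ M * √(τ n) := by
      have hle : τ n ≤ √(τ n) := (Real.le_sqrt' (hτ n)).2 (by nlinarith [hτ n, hτ1 n])
      have hfl : N (n + 1) t = 2 * N n t ∨ N (n + 1) t = 2 * N n t + 1 := by
        have : t / τ (n + 1) = t / τ n * 2 := by rw [hτs]; field_simp
        simp only [hN, this]
        exact floor_two_mul_eq _ (div_nonneg ht (hτ n).le)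
      simp only [hU]
      rcases hfl with h | h
      · rw [h, sub_self, norm_zero]; positivity
      · rw [h, norm_sub_rev]
        refine ((hu (n + 1)).norm_sub_succ_le (hτ _) _).trans ?_
        rw [hξ0, hτs]
        nlinarith [hτ n]
    rw [hsq, dist_eq_norm]
    calc _ ≤ _ := norm_sub_le_norm_sub_add_norm_sub _ (u (n + 1) (2 * N n t)) _
      _ ≤ _ := add_le_add h2 h3
      _ = _ := by ring
  have hr : √(1 / 2 : ℝ) < 1 := by
    rw [Real.sqrt_lt' one_pos]; norm_num
  -- Negative times are clamped to 0, so that the limit curve is Lipschitz on the whole line.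
  have hex : ∀ t : ℝ, ∃ z, Tendsto (fun n => U n (max t 0)) atTop (𝓝 z) := fun t =>
    cauchySeq_tendsto_of_complete
      (cauchySeq_of_le_geometric _ _ hr fun n => hcomp n _ (le_max_right _ _))
  choose w hw using hex
  have hw' : ∀ t, 0 ≤ t → Tendsto (fun n => U n t) atTop (𝓝 (w t)) := fun t ht => by
    simpa [max_eq_left ht] using hw t
  have hUD : ∀ n t, U n t ∈ D := fun n t => ((hu n).subgrad _).1
  have hNmono : ∀ n s t, s ≤ t → N n s ≤ N n t := fun n s t h =>
    Nat.floor_le_floor (div_le_div_of_nonneg_right h (hτ n).le)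
  have hLip : ∀ s t, 0 ≤ s → s ≤ t → ‖w t - w s‖ ≤ M * (t - s) := by
    intro s t hs hst
    have h1 : ∀ n, ‖U n t - U n s‖ ≤ M * (τ n * N n t - τ n * N n s) := by
      intro n
      obtain ⟨i, hi⟩ := Nat.exists_eq_add_of_le (hNmono n s t hst)
      simp only [hU]
      rw [hi]
      refine ((hu n).norm_add_sub_le (hτ n) _ _).trans_eq ?_
      rw [hξ0]; push_cast; ring
    exact le_of_tendsto_of_tendsto' ((hw' t (hs.trans hst)).sub (hw' s hs)).norm
      (((hNlim t (hs.trans hst)).sub (hNlim s hs)).const_mul M) h1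
  refine ⟨w, ?_, ?_, ?_, ?_⟩
  · refine tendsto_nhds_unique (hw' 0 le_rfl) ?_
    simp only [hU, hN, zero_div, Nat.floor_zero, hu0]
    exact tendsto_const_nhds
  · have hmax : ∀ t, w t = w (max t 0) := fun t => by
      refine tendsto_nhds_unique (hw t) ?_
      simpa using hw (max t 0)
    refine LipschitzWith.of_dist_le_mul fun t s => ?_
    wlog hst : s ≤ t generalizing s t
    · rw [dist_comm, dist_comm t]; exact this s t (le_of_not_ge hst)
    rw [hmax t, hmax s, dist_eq_norm, coe_nnnorm]
    refine (hLip _ _ (le_max_right _ _) (max_le_max_right 0 hst)).trans ?_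
    refine mul_le_mul_of_nonneg_left ?_ hM
    rw [Real.dist_eq, abs_of_nonneg (sub_nonneg.2 hst)]
    rcases le_total s 0 with h1 | h1 <;> rcases le_total t 0 with h2 | h2 <;>
      simp [h1, h2] <;> linarith
  · intro t
    exact (mem_and_le_of_tendsto hcl (hw t) (Eventually.of_forall fun n => hUD n _)
      (Eventually.of_forall fun n => (hu n).energy_le (hτ n) _)
      (k := fun n => e (u n 0)) (K := e x₀) (by simp only [hu0]; exact tendsto_const_nhds)).1
  · intro v hv s t hs hst
    have ht := hs.trans hst.le
    set Δ : ℕ → ℝ := fun n => τ n * N n t - τ n * N n s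
    have hΔ : Tendsto Δ atTop (𝓝 (t - s)) := (hNlim t ht).sub (hNlim s hs)
    have hΔpos : ∀ᶠ n in atTop, 0 < Δ n := hΔ.eventually_const_lt (sub_pos.2 hst)
    -- Dividing by the discrete elapsed time makes the discrete inequality an upper bound for the
    -- energy of `U n t`, the form in which closed sublevel sets carry it to the limit.
    have hlim : Tendsto (fun n => e v - (‖U n t - v‖ ^ 2 / 2 - ‖U n s - v‖ ^ 2 / 2) / Δ n) atTop
        (𝓝 (e v - (‖w t - v‖ ^ 2 / 2 - ‖w s - v‖ ^ 2 / 2) / (t - s))) :=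
      tendsto_const_nhds.sub ((((((hw' t ht).sub_const v).norm.pow 2).div_const 2).sub
        ((((hw' s hs).sub_const v).norm.pow 2).div_const 2)).div hΔ (sub_pos.2 hst).ne')
    have h := (mem_and_le_of_tendsto hcl (hw' t ht) (Eventually.of_forall fun n => hUD n _)
      (by
        filter_upwards [hΔpos] with n hn
        obtain ⟨i, hi⟩ := Nat.exists_eq_add_of_le (hNmono n s t hst.le)
        have h1 := (hu n).evi (hτ n) hv (N n s) i
        rw [← hi] at h1
        have h2 : τ n * i = Δ n := by simp only [Δ]; rw [hi]; push_cast; ring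
        rw [h2] at h1
        have h3 : (‖U n t - v‖ ^ 2 / 2 - ‖U n s - v‖ ^ 2 / 2) / Δ n ≤ e v - e (U n t) := by
          rw [div_le_iff₀ hn, mul_comm]; exact h1
        linarith) hlim).2
    have h4 : (‖w t - v‖ ^ 2 / 2 - ‖w s - v‖ ^ 2 / 2) / (t - s) ≤ e v - e (w t) := by linarith
    rw [div_le_iff₀ (sub_pos.2 hst)] at h4
    linarith

/-- At a point of differentiability, the evolution variational inequality gives the subgradient
inclusion. -/
theorem isSubgradient_neg_deriv {D : Set H} {e : H → ℝ} {w : ℝ → H} {t : ℝ} {w' : H} (ht : 0 < t)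
    (hD : w t ∈ D)
    (hevi : ∀ v ∈ D, ∀ s, 0 ≤ s → s < t →
        ‖w t - v‖ ^ 2 / 2 - ‖w s - v‖ ^ 2 / 2 ≤ (t - s) * (e v - e (w t)))
    (hw : HasDerivAt w w' t) : IsSubgradient D e (w t) (-w') := by
  refine ⟨hD, fun v hv => ?_⟩
  have h1 : HasDerivAt (fun s => ‖w s - v‖ ^ 2) (2 * ⟪w t - v, w'⟫) t := (hw.sub_const v).norm_sq
  -- The evolution inequality relates t only to earlier times, so left difference quotients are
  -- used; this is why 0 < t is needed.
  have h2 := (hasDerivAt_iff_tendsto_slope_left_right.1 h1).1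
  have h3 : 2 * ⟪w t - v, w'⟫ ≤ 2 * (e v - e (w t)) := by
    refine le_of_tendsto h2 ?_
    filter_upwards [Ioo_mem_nhdsLT ht] with s hs
    have h4 := hevi v hv s hs.1.le hs.2
    have h5 : slope (fun s => ‖w s - v‖ ^ 2) t s =
        2 * ((‖w t - v‖ ^ 2 / 2 - ‖w s - v‖ ^ 2 / 2) / (t - s)) := by
      rw [slope_def_field]
      have : t - s ≠ 0 := (sub_pos.2 hs.2).ne'
      have : s - t ≠ 0 := (sub_neg.2 hs.2).ne
      field_simp
      ring
    rw [h5]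
    refine mul_le_mul_of_nonneg_left ?_ zero_le_two
    rw [div_le_iff₀ (sub_pos.2 hs.2)]
    linarith
  have h6 : ⟪-w', v - w t⟫ = ⟪w t - v, w'⟫ := by
    rw [inner_neg_left, ← inner_neg_right, neg_sub, real_inner_comm]
  rw [h6]
  linarith

end GradientFlowLimit

end ThinFilm

/-! ### Almost everywhere differentiability of Lipschitz curves. -/

namespace ThinFilm

section Lipschitz

open Filter Topology
open scoped RealInnerProductSpace NNReal

theorem lipschitzOnWith_integral {F : Type*} [NormedAddCommGroup F] [NormedSpace ℝ F]
    {f : ℝ → F} {a b : ℝ} {K : ℝ≥0} (hint : IntervalIntegrable f volume a b)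
    (hK : ∀ᵐ x, x ∈ uIoc a b → ‖f x‖ ≤ K) :
    LipschitzOnWith K (fun x => ∫ t in a..x, f t) (uIcc a b) := by
  refine LipschitzOnWith.of_dist_le_mul fun x hx y hy => ?_
  have hsub : ∀ z ∈ uIcc a b, IntervalIntegrable f volume a z := fun z hz =>
    hint.mono_set (uIcc_subset_uIcc left_mem_uIcc hz)
  rw [dist_eq_norm, intervalIntegral.integral_interval_sub_left (hsub x hx) (hsub y hy),
    Real.dist_eq]
  refine intervalIntegral.norm_integral_le_of_norm_le_const_ae ?_
  filter_upwards [hK] with z hz hz'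
  refine hz ?_
  simp only [uIoc, uIcc, mem_Ioc, mem_Icc] at *
  exact ⟨lt_of_le_of_lt (le_min hy.1 hx.1) hz'.1, hz'.2.trans (max_le hy.2 hx.2)⟩

/-- The fundamental theorem of calculus for vector-valued absolutely continuous functions with a
bounded almost everywhere derivative. -/
theorem integral_eq_sub_of_ae_hasDerivAt {F : Type*} [NormedAddCommGroup F] [NormedSpace ℝ F]
    [CompleteSpace F] {f f' : ℝ → F} {a b : ℝ} {K : ℝ≥0} (hf : AbsolutelyContinuousOnInterval f a b)
    (hderiv : ∀ᵐ x, x ∈ uIcc a b → HasDerivAt f (f' x) x)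
    (hint : IntervalIntegrable f' volume a b)
    (hK : ∀ᵐ x, x ∈ uIoc a b → ‖f' x‖ ≤ K) :
    ∫ t in a..b, f' t = f b - f a := by
  have hI := (lipschitzOnWith_integral hint hK).absolutelyContinuousOnInterval
  -- The difference of f and the primitive of f' is absolutely continuous with derivative zero
  -- almost everywhere.
  obtain ⟨C, hC⟩ := (hf.sub hI).const_of_ae_hasDerivAt_zero (by
    filter_upwards [hderiv, hint.ae_hasDerivAt_integral] with x h1 h2 hx
    simpa using (h1 hx).sub (h2 hx a left_mem_uIcc))
  have h1 := hC a left_mem_uIcc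
  have h2 := hC b right_mem_uIcc
  simp only [Pi.sub_apply, intervalIntegral.integral_same, sub_zero] at h1 h2
  rw [h1, ← h2, sub_sub_cancel]

variable {H : Type*} [NormedAddCommGroup H] [InnerProductSpace ℝ H] [CompleteSpace H]

-- Distinct basis vectors are √2 apart, so the balls of radius 1/2 around them are disjoint nonempty
-- open sets.
omit [CompleteSpace H] in
theorem _root_.HilbertBasis.countable_index [SecondCountableTopology H] {ι : Type*}
    (b : HilbertBasis ι ℝ H) : Countable ι := by
  refine Pairwise.countable_of_isOpen_disjoint (s := fun i => Metric.ball (b i) (1 / 2)) ?_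
    (fun i => Metric.isOpen_ball) (fun i => ⟨b i, Metric.mem_ball_self (by norm_num)⟩)
  intro i j hij
  refine Metric.ball_disjoint_ball ?_
  have h1 : ‖b i - b j‖ ^ 2 = 2 := by
    rw [norm_sub_sq_real, b.orthonormal.2 hij, b.orthonormal.1 i, b.orthonormal.1 j]
    norm_num
  rw [dist_eq_norm]
  nlinarith [norm_nonneg (b i - b j)]

/-- Lipschitz curves in a separable Hilbert space are differentiable almost everywhere. -/
theorem _root_.LipschitzWith.ae_differentiableAt_hilbert [SecondCountableTopology H] {K : ℝ≥0}
    {w : ℝ → H} (hw : LipschitzWith K w) : ∀ᵐ t, DifferentiableAt ℝ w t := by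
  obtain ⟨s, b, -⟩ := exists_hilbertBasis ℝ H
  have := b.countable_index
  set f : s → ℝ → ℝ := fun i t => ⟪b i, w t⟫ with hfdef
  have hbn : ∀ i, ‖b i‖ = 1 := fun i => b.orthonormal.1 i
  have hf : ∀ i, LipschitzWith K (f i) := fun i =>
    LipschitzWith.of_dist_le_mul fun x y => by
      rw [Real.dist_eq, hfdef]
      simp only
      rw [← inner_sub_right]
      refine (abs_real_inner_le_norm _ _).trans ?_
      rw [hbn, one_mul, ← dist_eq_norm]
      exact hw.dist_le_mul x y
  have hfd : ∀ᵐ t, ∀ i, DifferentiableAt ℝ (f i) t :=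
    ae_all_iff.2 fun i => (hf i).ae_differentiableAt_real
  -- Bessel's inequality for the difference quotients of w, whose norm is at most K, passes to the
  -- limit in each finite sum. The coefficientwise derivatives are thus the coefficients of a
  -- vector.
  have hbes : ∀ t, (∀ i, DifferentiableAt ℝ (f i) t) → ∀ F : Finset s,
      ∑ i ∈ F, ‖deriv (f i) t‖ ^ 2 ≤ (K : ℝ) ^ 2 := by
    intro t ht F
    have h1 : Tendsto (fun y => ∑ i ∈ F, ‖slope (f i) t y‖ ^ 2) (𝓝[≠] t)
        (𝓝 (∑ i ∈ F, ‖deriv (f i) t‖ ^ 2)) :=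
      tendsto_finsetSum _ fun i _ =>
        ((hasDerivAt_iff_tendsto_slope.1 (ht i).hasDerivAt).norm.pow 2)
    refine le_of_tendsto h1 ?_
    filter_upwards [self_mem_nhdsWithin] with y hy
    have h2 : ∀ i, slope (f i) t y = ⟪b i, (y - t)⁻¹ • (w y - w t)⟫ := by
      intro i
      rw [slope_def_field, inner_smul_right, inner_sub_right]
      ring
    simp only [h2]
    refine (b.orthonormal.sum_inner_products_le _).trans ?_
    have hyt : 0 < |y - t| := abs_pos.2 (sub_ne_zero.2 hy)
    have h3 : ‖(y - t)⁻¹ • (w y - w t)‖ ≤ K := by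
      rw [norm_smul, norm_inv, Real.norm_eq_abs, inv_mul_le_iff₀ hyt, mul_comm]
      have := hw.dist_le_mul y t
      rwa [dist_eq_norm, Real.dist_eq] at this
    exact pow_le_pow_left₀ (norm_nonneg _) h3 2
  set S : Set ℝ := ⋂ i, {t | DifferentiableAt ℝ (f i) t} with hS
  have hSm : MeasurableSet S := MeasurableSet.iInter fun i => measurableSet_of_differentiableAt ℝ _
  -- Extension by zero off S makes the square-sum bound hold at every t, so g below is defined and
  -- bounded everywhere.
  set d : s → ℝ → ℝ := fun i => S.indicator (deriv (f i)) with hd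
  have hdF : ∀ t, ∀ F : Finset s, ∑ i ∈ F, ‖d i t‖ ^ (2 : ℝ≥0∞).toReal ≤
      (K : ℝ) ^ (2 : ℝ≥0∞).toReal := by
    intro t F
    simp only [ENNReal.toReal_ofNat, Real.rpow_ofNat]
    by_cases ht : t ∈ S
    · simp only [hd, indicator_of_mem ht]
      exact hbes t (by simpa [hS] using ht) F
    · simp only [hd, indicator_of_notMem ht, norm_zero]
      simp
  set c : ℝ → lp (fun _ : s => ℝ) 2 := fun t => ⟨fun i => d i t, memℓp_gen' (hdF t)⟩ with hc
  set g : ℝ → H := fun t => b.repr.symm (c t) with hg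
  have hgm : StronglyMeasurable g := by
    refine stronglyMeasurable_of_tendsto (atTop : Filter (Finset s))
      (f := fun F t => ∑ i ∈ F, d i t • b i) (fun F => ?_) ?_
    · refine Finset.stronglyMeasurable_fun_sum _ fun i _ => ?_
      exact (((measurable_deriv (f i)).indicator hSm).stronglyMeasurable).smul_const _
    · rw [tendsto_pi_nhds]
      intro t
      exact b.hasSum_repr_symm (c t)
  have hgK : ∀ t, ‖g t‖ ≤ K := by
    intro t
    rw [hg]
    simp only
    rw [LinearIsometryEquiv.norm_map]
    exact lp.norm_le_of_forall_sum_le (by norm_num) K.2 (hdF t)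
  have hgi : ∀ a b : ℝ, IntervalIntegrable g volume a b := fun a b =>
    (intervalIntegrable_const (c := (K : ℝ))).mono_fun hgm.aestronglyMeasurable
      (Eventually.of_forall fun t => by simpa using hgK t)
  have hgl : LocallyIntegrable g volume := by
    refine (locallyIntegrable_const (K : ℝ)).mono hgm.aestronglyMeasurable
      (Eventually.of_forall fun t => by simpa using hgK t)
  have hinner : ∀ t i, ⟪b i, g t⟫ = d i t := fun t i => by
    rw [← b.repr_apply_apply, hg]
    simp [hc]
  -- Comparing coefficients, each a scalar Lipschitz function, shows that w is a primitive of g;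
  -- Lebesgue differentiation then applies to g.
  have hrep : ∀ x, w x = w 0 + ∫ t in (0 : ℝ)..x, g t := by
    intro x
    apply b.repr.injective
    ext i
    rw [b.repr_apply_apply, b.repr_apply_apply, inner_add_right]
    have h1 : ⟪b i, ∫ t in (0 : ℝ)..x, g t⟫ = ∫ t in (0 : ℝ)..x, d i t := by
      rw [← innerSL_apply_apply ℝ, ← ContinuousLinearMap.intervalIntegral_comp_comm _ (hgi 0 x)]
      simp only [innerSL_apply_apply, hinner]
    have hac : AbsolutelyContinuousOnInterval (f i) 0 x :=
      (hf i).lipschitzOnWith.absolutelyContinuousOnInterval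
    have h2 := hac.integral_deriv_eq_sub
    have h3 : ∫ t in (0 : ℝ)..x, d i t = ∫ t in (0 : ℝ)..x, deriv (f i) t := by
      refine intervalIntegral.integral_congr_ae ?_
      filter_upwards [hfd] with t ht _
      exact indicator_of_mem (by simpa [hS] using ht) _
    rw [h1, h3, h2]
    simp [hfdef]
  filter_upwards [LocallyIntegrable.ae_hasDerivAt_integral hgl] with t ht
  have : w = fun x => w 0 + ∫ t in (0 : ℝ)..x, g t := funext hrep
  rw [this]
  exact ((ht 0).const_add _).differentiableAt

end Lipschitz

end ThinFilm

/-! ### Weak time derivatives of vector-valued functions. -/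

namespace ThinFilm

section WeakDerivative

open Filter Topology
open scoped RealInnerProductSpace NNReal

theorem ae_restrict_Icc_of_bound {F : Type*} [NormedAddCommGroup F] {T : ℝ} (hT : 0 ≤ T)
    {f : ℝ → F} {K : ℝ≥0} (hm : AEStronglyMeasurable f (volume.restrict (Icc 0 T)))
    (hK : ∀ᵐ x, x ∈ Icc 0 T → ‖f x‖ ≤ K) : IntervalIntegrable f volume 0 T := by
  rw [intervalIntegrable_iff_integrableOn_Icc_of_le hT]
  exact Integrable.of_bound hm K ((ae_restrict_iff' measurableSet_Icc).2 hK)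

/-- Integration by parts against a smooth test function. -/
theorem integral_deriv_smul_eq_neg {F : Type*} [NormedAddCommGroup F] [NormedSpace ℝ F]
    [CompleteSpace F] {f f' : ℝ → F} {T : ℝ} (hT : 0 ≤ T) {K L : ℝ≥0}
    (hf : LipschitzOnWith K f (Icc 0 T))
    (hderiv : ∀ᵐ x, x ∈ Icc 0 T → HasDerivAt f (f' x) x)
    (hm : AEStronglyMeasurable f' (volume.restrict (Icc 0 T)))
    (hL : ∀ᵐ x, x ∈ Icc 0 T → ‖f' x‖ ≤ L)
    {θ : ℝ → ℝ} (hθ : ContDiff ℝ ∞ θ) (hsupp : tsupport θ ⊆ Ioo 0 T) :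
    ∫ t in Icc 0 T, deriv θ t • f t = -∫ t in Icc 0 T, θ t • f' t := by
  have hu : uIcc 0 T = Icc 0 T := uIcc_of_le hT
  have hθ0 : θ 0 = 0 := image_eq_zero_of_notMem_tsupport fun h => lt_irrefl _ (hsupp h).1
  have hθT : θ T = 0 := image_eq_zero_of_notMem_tsupport fun h => lt_irrefl _ (hsupp h).2
  have hfc : ContinuousOn f (uIcc 0 T) := hu ▸ hf.continuousOn
  have hdθ : Continuous (deriv θ) := hθ.continuous_deriv (by simp)
  have hd : ∀ t, HasDerivAt θ (deriv θ t) t := fun t =>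
    ((hθ.differentiable (by simp)) t).hasDerivAt
  obtain ⟨A, hA⟩ := isCompact_Icc.exists_bound_of_continuousOn (s := Icc 0 T) hθ.continuous.continuousOn
  obtain ⟨B, hB⟩ := isCompact_Icc.exists_bound_of_continuousOn (s := Icc 0 T) hdθ.continuousOn
  obtain ⟨C, hC⟩ := isCompact_Icc.exists_bound_of_continuousOn (s := Icc 0 T) hf.continuousOn
  have h0 : (0 : ℝ) ∈ Icc 0 T := left_mem_Icc.2 hT
  have hA0 : 0 ≤ A := (norm_nonneg _).trans (hA 0 h0)
  have hB0 : 0 ≤ B := (norm_nonneg _).trans (hB 0 h0)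
  have hC0 : 0 ≤ C := (norm_nonneg _).trans (hC 0 h0)
  have hi1 : IntervalIntegrable (fun t => θ t • f' t) volume 0 T :=
    (ae_restrict_Icc_of_bound hT hm hL).continuousOn_smul hθ.continuous.continuousOn
  have hi2 : IntervalIntegrable (fun t => deriv θ t • f t) volume 0 T :=
    (hdθ.continuousOn.smul hfc).intervalIntegrable
  have hac : AbsolutelyContinuousOnInterval (θ • f) 0 T := by
    refine AbsolutelyContinuousOnInterval.smul ?_ ?_
    · exact (hθ.of_le (by exact_mod_cast le_top)).contDiffOn.absolutelyContinuousOnInterval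
    · exact (hu ▸ hf).absolutelyContinuousOnInterval
  have key := integral_eq_sub_of_ae_hasDerivAt (f := θ • f)
    (f' := fun t => θ t • f' t + deriv θ t • f t) (K := ⟨A * L + B * C, by positivity⟩) hac (by
      filter_upwards [hderiv] with x hx hx'
      exact (hd x).smul (hx (hu ▸ hx'))) (hi1.add hi2) (by
      filter_upwards [hL] with x hx hx'
      rw [uIoc_of_le hT] at hx'
      have hx'' : x ∈ Icc 0 T := Ioc_subset_Icc_self hx'
      refine (norm_add_le _ _).trans (add_le_add ?_ ?_)
      · rw [norm_smul]
        exact mul_le_mul (hA x hx'') (hx hx'') (norm_nonneg _) hA0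
      · rw [norm_smul]
        exact mul_le_mul (hB x hx'') (hC x hx'') (norm_nonneg _) hB0)
  rw [intervalIntegral.integral_add hi1 hi2] at key
  simp only [Pi.smul_apply', hθ0, hθT, zero_smul, sub_zero] at key
  rw [intervalIntegral.integral_of_le hT, intervalIntegral.integral_of_le hT,
    ← integral_Icc_eq_integral_Ioc, ← integral_Icc_eq_integral_Ioc] at key
  exact eq_neg_of_add_eq_zero_right key

/-- A test function with vanishing mean has a compactly supported smooth primitive. -/
theorem exists_primitive_testFunction {T : ℝ} {p : ℝ → ℝ} (hp : ContDiff ℝ ∞ p)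
    (hc : HasCompactSupport p) (hsupp : tsupport p ⊆ Ioo 0 T) (h0 : ∫ t, p t = 0) :
    ∃ θ : ℝ → ℝ, ContDiff ℝ ∞ θ ∧ HasCompactSupport θ ∧ tsupport θ ⊆ Ioo 0 T ∧ deriv θ = p := by
  rcases (tsupport p).eq_empty_or_nonempty with he | hne
  · have : p = 0 := tsupport_eq_empty_iff.1 he
    subst this
    exact ⟨0, contDiff_const, HasCompactSupport.zero, by simp [tsupport], by ext; simp⟩
  obtain ⟨a, ha⟩ := hc.isCompact.exists_isLeast hne
  obtain ⟨b, hb⟩ := hc.isCompact.exists_isGreatest hne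
  have ha' := hsupp ha.1
  have hb' := hsupp hb.1
  have hlow : ∀ t, t < a → p t = 0 := fun t ht =>
    image_eq_zero_of_notMem_tsupport fun h => not_le.2 ht (ha.2 h)
  have hhigh : ∀ t, b < t → p t = 0 := fun t ht =>
    image_eq_zero_of_notMem_tsupport fun h => not_le.2 ht (hb.2 h)
  have hi : Integrable p := hp.continuous.integrable_of_hasCompactSupport hc
  set θ : ℝ → ℝ := fun t => ∫ s in Iic t, p s with hθ
  have hθ' : ∀ t, θ t = (∫ s in Iic 0, p s) + ∫ s in (0 : ℝ)..t, p s := fun t => by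
    rw [← intervalIntegral.integral_Iic_sub_Iic hi.integrableOn hi.integrableOn]
    simp only [hθ]
    ring
  have hd : ∀ t, HasDerivAt θ (p t) t := fun t => by
    rw [show θ = _ from funext hθ']
    exact (hp.continuous.integral_hasStrictDerivAt 0 t).hasDerivAt.const_add _
  have hderiv : deriv θ = p := funext fun t => (hd t).deriv
  have hθlow : ∀ t, t < a → θ t = 0 := fun t ht => by
    refine setIntegral_eq_zero_of_forall_eq_zero fun s hs => hlow s (lt_of_le_of_lt hs ht)
  have hθhigh : ∀ t, b < t → θ t = 0 := fun t ht => by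
    rw [← h0]
    refine setIntegral_eq_integral_of_forall_compl_eq_zero fun s hs => hhigh s ?_
    exact ht.trans (not_le.1 hs)
  have hts : tsupport θ ⊆ Icc a b := by
    refine closure_minimal (fun t ht => ?_) isClosed_Icc
    by_contra hcon
    rw [mem_Icc, not_and_or, not_le, not_le] at hcon
    exact ht (hcon.elim (hθlow t) (hθhigh t))
  refine ⟨θ, ?_, ?_, hts.trans fun t ht => ⟨ha'.1.trans_le ht.1, ht.2.trans_lt hb'.2⟩, hderiv⟩
  · rw [contDiff_infty_iff_deriv, hderiv]
    exact ⟨fun t => (hd t).differentiableAt, hp⟩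
  · exact HasCompactSupport.of_support_subset_isCompact isCompact_Icc
      ((subset_tsupport θ).trans hts)

/-- The du Bois-Reymond lemma for continuous functions. -/
theorem eqOn_const_of_integral_deriv_smul_eq_zero {F : Type*} [NormedAddCommGroup F]
    [NormedSpace ℝ F] [CompleteSpace F] {f : ℝ → F} {T : ℝ} (hT : 0 < T)
    (hf : ContinuousOn f (Icc 0 T))
    (h : ∀ θ : ℝ → ℝ, ContDiff ℝ ∞ θ → HasCompactSupport θ → tsupport θ ⊆ Ioo 0 T →
      ∫ t in Icc 0 T, deriv θ t • f t = 0) : ∃ c, EqOn f (fun _ => c) (Icc 0 T) := by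
  obtain ⟨r, hrs, hrc, hrd, hr0⟩ : ∃ r : ℝ → ℝ, tsupport r ⊆ Ioo 0 T ∧ HasCompactSupport r ∧
      ContDiff ℝ ∞ r ∧ ∫ t, r t = 1 := by
    let φ : ContDiffBump (T / 2 : ℝ) := ⟨T / 8, T / 4, by positivity, by linarith⟩
    refine ⟨φ.normed volume, ?_, φ.hasCompactSupport_normed, φ.contDiff_normed, φ.integral_normed⟩
    rw [φ.tsupport_normed_eq, Real.closedBall_eq_Icc]
    intro t ht
    simp only [φ, mem_Icc] at ht
    constructor <;> linarith [ht.1, ht.2]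
  have hsm : ∀ p : ℝ → ℝ, Continuous p → IntegrableOn (fun t => p t • f t) (Icc 0 T) := fun p hp =>
    (hp.continuousOn.smul hf).integrableOn_Icc
  have hrest : ∀ p : ℝ → ℝ, tsupport p ⊆ Ioo 0 T → ∀ g : ℝ → F,
      ∫ t, p t • g t = ∫ t in Icc 0 T, p t • g t := fun p hp g => by
    refine (setIntegral_eq_integral_of_forall_compl_eq_zero fun t ht => ?_).symm
    rw [image_eq_zero_of_notMem_tsupport fun h => ht (Ioo_subset_Icc_self (hp h)), zero_smul]
  set c : F := ∫ t in Icc 0 T, r t • f t with hc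
  refine ⟨c, ?_⟩
  have hae : ∀ᵐ t, t ∈ Ioo 0 T → f t - c = 0 := by
    refine isOpen_Ioo.ae_eq_zero_of_integral_contDiff_smul_eq_zero ?_ fun p hp hpc hps => ?_
    · have : LocallyIntegrableOn (fun t => f t - c) (Icc 0 T) :=
        ((hf.sub continuousOn_const).integrableOn_Icc).locallyIntegrableOn
      exact this.mono_set Ioo_subset_Icc_self
    -- Since r has integral one, q has mean zero and is the derivative of a test function. The
    -- hypothesis for that function says that p integrates f - c to zero, with c the r-average of f.
    · set q : ℝ → ℝ := fun t => p t - (∫ s, p s) * r t with hq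
      have hqs : Function.support q ⊆ tsupport p ∪ tsupport r := fun t ht => by
        by_contra hcon
        rw [mem_union, not_or] at hcon
        exact ht (by simp [hq, image_eq_zero_of_notMem_tsupport hcon.1,
          image_eq_zero_of_notMem_tsupport hcon.2])
      have hqt : tsupport q ⊆ tsupport p ∪ tsupport r :=
        closure_minimal hqs ((isClosed_tsupport _).union (isClosed_tsupport _))
      have hpi : Integrable p := hp.continuous.integrable_of_hasCompactSupport hpc
      have hri : Integrable r := hrd.continuous.integrable_of_hasCompactSupport hrc
      obtain ⟨θ, h1, h2, h3, h4⟩ := exists_primitive_testFunction (T := T) (p := q)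
        (hp.sub (contDiff_const.mul hrd))
        (HasCompactSupport.of_support_subset_isCompact (hpc.isCompact.union hrc.isCompact) hqs)
        (hqt.trans (union_subset hps hrs)) (by
          simp only [hq]
          rw [integral_sub hpi (hri.const_mul _), integral_const_mul, hr0, mul_one, sub_self])
      have h5 := h θ h1 h2 h3
      rw [h4] at h5
      simp only [hq, sub_smul, mul_smul] at h5
      have h6 : IntegrableOn (fun t => (∫ s, p s) • r t • f t) (Icc 0 T) :=
        (hsm r hrd.continuous).smul (∫ s, p s)
      rw [integral_sub (hsm p hp.continuous) h6, integral_smul] at h5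
      rw [hrest p hps]
      simp only [smul_sub]
      rw [integral_sub (hsm p hp.continuous) (hpi.smul_const c).integrableOn,
        ← hrest p hps (fun _ => c), integral_smul_const]
      exact h5
  refine Measure.eqOn_Icc_of_ae_eq volume hT.ne ?_ hf continuousOn_const
  rw [Filter.EventuallyEq, ← Measure.restrict_congr_set Ioo_ae_eq_Icc,
    ae_restrict_iff' measurableSet_Ioo]
  filter_upwards [hae] with t ht ht'
  exact sub_eq_zero.1 (ht ht')

/-- A continuous function with a bounded weak derivative is the primitive of that derivative. -/
theorem eq_add_integral_of_weakDeriv {F : Type*} [NormedAddCommGroup F] [NormedSpace ℝ F]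
    [CompleteSpace F] {f f' : ℝ → F} {T : ℝ} (hT : 0 < T) {L : ℝ≥0}
    (hf : ContinuousOn f (Icc 0 T))
    (hm : AEStronglyMeasurable f' (volume.restrict (Icc 0 T)))
    (hL : ∀ᵐ x, x ∈ Icc 0 T → ‖f' x‖ ≤ L)
    (hweak : ∀ θ : ℝ → ℝ, ContDiff ℝ ∞ θ → HasCompactSupport θ → tsupport θ ⊆ Ioo 0 T →
      ∫ t in Icc 0 T, deriv θ t • f t = -∫ t in Icc 0 T, θ t • f' t) :
    ∀ t ∈ Icc 0 T, f t = f 0 + ∫ s in (0 : ℝ)..t, f' s := by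
  have hu : uIcc 0 T = Icc 0 T := uIcc_of_le hT.le
  have hint := ae_restrict_Icc_of_bound hT.le hm hL
  set G : ℝ → F := fun t => ∫ s in (0 : ℝ)..t, f' s with hG
  have hGL : LipschitzOnWith L G (Icc 0 T) := by
    rw [← hu]
    refine lipschitzOnWith_integral hint ?_
    filter_upwards [hL] with x hx hx'
    rw [uIoc_of_le hT.le] at hx'
    exact hx (Ioc_subset_Icc_self hx')
  have hGd : ∀ᵐ x, x ∈ Icc 0 T → HasDerivAt G (f' x) x := by
    filter_upwards [hint.ae_hasDerivAt_integral] with x hx hx'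
    exact hx (hu ▸ hx') 0 left_mem_uIcc
  obtain ⟨c, hc⟩ := eqOn_const_of_integral_deriv_smul_eq_zero (f := fun t => f t - G t) hT
    (hf.sub hGL.continuousOn) fun θ h1 h2 h3 => by
      have hdθ : Continuous (deriv θ) := h1.continuous_deriv (by simp)
      simp only [smul_sub]
      have h4 : IntegrableOn (fun t => deriv θ t • f t) (Icc 0 T) :=
        (hdθ.continuousOn.smul hf).integrableOn_Icc
      have h5 : IntegrableOn (fun t => deriv θ t • G t) (Icc 0 T) :=
        (hdθ.continuousOn.smul hGL.continuousOn).integrableOn_Icc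
      rw [integral_sub h4 h5, hweak θ h1 h2 h3,
        integral_deriv_smul_eq_neg hT.le hGL hGd hm hL h1 h3, sub_self]
  intro t ht
  have e1 := hc ht
  have e2 := hc (left_mem_Icc.2 hT.le)
  simp only [hG, intervalIntegral.integral_same, sub_zero] at e1 e2
  rw [e2, ← e1]
  abel

variable {H : Type*} [NormedAddCommGroup H] [InnerProductSpace ℝ H]

/-- A Lipschitz curve whose velocity points inwards stays at the origin. -/
theorem eqOn_zero_of_inner_deriv_nonpos {d d' : ℝ → H} {T : ℝ} {K : ℝ≥0}
    (hd : LipschitzOnWith K d (Icc 0 T)) (hderiv : ∀ᵐ x, x ∈ Icc 0 T → HasDerivAt d (d' x) x)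
    (hle : ∀ᵐ x, x ∈ Icc 0 T → ⟪d x, d' x⟫ ≤ 0) (h0 : d 0 = 0) :
    ∀ t ∈ Icc 0 T, d t = 0 := by
  intro t ht
  have hsub : Icc 0 t ⊆ Icc 0 T := Icc_subset_Icc_right ht.2
  have hn : LipschitzOnWith K (fun s => ‖d s‖) (uIcc 0 t) := by
    rw [uIcc_of_le ht.1]
    refine LipschitzOnWith.of_dist_le_mul fun x hx y hy => ?_
    refine le_trans ?_ (hd.dist_le_mul x (hsub hx) y (hsub hy))
    rw [Real.dist_eq, dist_eq_norm]
    exact abs_norm_sub_norm_le _ _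
  have hac := hn.absolutelyContinuousOnInterval.fun_mul hn.absolutelyContinuousOnInterval
  have h1 := hac.integral_deriv_eq_sub
  have h2 : ∫ x in (0 : ℝ)..t, deriv (fun s => ‖d s‖ * ‖d s‖) x ≤ ∫ x in (0 : ℝ)..t, (0 : ℝ) := by
    refine intervalIntegral.integral_mono_ae_restrict ht.1 hac.intervalIntegrable_deriv
      intervalIntegrable_const ?_
    rw [Filter.EventuallyLE, ae_restrict_iff' measurableSet_Icc]
    filter_upwards [hderiv, hle] with x h3 h4 hx
    have h5 := (h3 (hsub hx)).norm_sq
    have h6 : (fun s => ‖d s‖ * ‖d s‖) = fun s => ‖d s‖ ^ 2 := by ext; ring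
    rw [h6, h5.deriv]
    linarith [h4 (hsub hx)]
  rw [h1, h0] at h2
  simp only [intervalIntegral.integral_zero, norm_zero, mul_zero, sub_zero] at h2
  exact norm_eq_zero.1 (mul_self_eq_zero.1 (le_antisymm h2 (mul_self_nonneg _)))

end WeakDerivative

end ThinFilm

/-! ### Smooth functions on the torus: density and primitives. -/

namespace ThinFilm

section SmoothFunctions

open Filter Topology

theorem torus_measureReal_univ : (volume : Measure Torus).real univ = 1 := by
  rw [measureReal_def, UnitAddCircle.measure_univ, ENNReal.toReal_one]

theorem smoothOnTorus_const (c : ℝ) : SmoothOnTorus (fun _ => c) := contDiff_const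

theorem SmoothOnTorus.sub {f g : Torus → ℝ} (hf : SmoothOnTorus f) (hg : SmoothOnTorus g) :
    SmoothOnTorus (fun x => f x - g x) := ContDiff.sub hf hg

theorem SmoothOnTorus.differentiable {f : Torus → ℝ} (hf : SmoothOnTorus f) :
    Differentiable ℝ (fun s : ℝ => f (s : Torus)) := ContDiff.differentiable hf (by simp)

theorem SmoothOnTorus.dh_add {f g : Torus → ℝ} (hf : SmoothOnTorus f) (hg : SmoothOnTorus g) :
    ThinFilm.dh (fun x => f x + g x) = fun x => ThinFilm.dh f x + ThinFilm.dh g x := by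
  funext x
  induction x using QuotientAddGroup.induction_on with | H t =>
  rw [dh_coe, dh_coe, dh_coe]
  exact deriv_fun_add (hf.differentiable t) (hg.differentiable t)

theorem SmoothOnTorus.dh_const_mul {f : Torus → ℝ} (hf : SmoothOnTorus f) (c : ℝ) :
    ThinFilm.dh (fun x => c * f x) = fun x => c * ThinFilm.dh f x := by
  funext x
  induction x using QuotientAddGroup.induction_on with | H t =>
  rw [dh_coe, dh_coe]
  exact deriv_const_mul c (hf.differentiable t)

theorem SmoothOnTorus.dh_sub_const {f : Torus → ℝ} (c : ℝ) :
    ThinFilm.dh (fun x => f x - c) = ThinFilm.dh f := by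
  funext x
  induction x using QuotientAddGroup.induction_on with | H t =>
  rw [dh_coe, dh_coe]
  exact deriv_sub_const c

/-- The smooth functions, as a subalgebra of `C(𝕋)`. -/
noncomputable def smoothFunctions : Subalgebra ℝ C(Torus, ℝ) where
  carrier := {f | SmoothOnTorus f}
  mul_mem' := fun {_ _} (ha : SmoothOnTorus _) (hb : SmoothOnTorus _) => ContDiff.mul ha hb
  add_mem' := fun {_ _} (ha : SmoothOnTorus _) (hb : SmoothOnTorus _) => ContDiff.add ha hb
  algebraMap_mem' := fun r => smoothOnTorus_const r

/-- The first Fourier character is injective on the torus, so its real or its imaginary part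
separates two given points. -/
theorem smoothFunctions_separatesPoints : smoothFunctions.SeparatesPoints := by
  intro x y hxy
  have hinj : (fourier 1 : C(Torus, ℂ)) x ≠ fourier 1 y := by
    simp only [fourier_one]
    exact fun h => hxy (AddCircle.injective_toCircle one_ne_zero (Subtype.ext h))
  have hsm : ContDiff ℝ ∞ (fun s : ℝ => (fourier 1 : C(Torus, ℂ)) (s : Torus)) := by
    simp only [fourier_coe_apply]
    exact ((contDiff_const.mul Complex.ofRealCLM.contDiff).div_const _).cexp
  have hre : SmoothOnTorus (fun z => ((fourier 1 : C(Torus, ℂ)) z).re) :=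
    Complex.reCLM.contDiff.comp hsm
  have him : SmoothOnTorus (fun z => ((fourier 1 : C(Torus, ℂ)) z).im) :=
    Complex.imCLM.contDiff.comp hsm
  by_cases h : ((fourier 1 : C(Torus, ℂ)) x).re = ((fourier 1 : C(Torus, ℂ)) y).re
  · refine ⟨_, ⟨⟨_, him.continuous⟩, him, rfl⟩, fun h' => hinj (Complex.ext h h')⟩
  · exact ⟨_, ⟨⟨_, hre.continuous⟩, hre, rfl⟩, h⟩

/-- Uniform approximation of continuous functions by smooth functions. -/
theorem exists_smooth_near {f : Torus → ℝ} (hf : Continuous f) {ε : ℝ} (hε : 0 < ε) :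
    ∃ g : Torus → ℝ, SmoothOnTorus g ∧ ∀ x, |g x - f x| < ε := by
  obtain ⟨g, hg⟩ := ContinuousMap.exists_mem_subalgebra_near_continuous_of_separatesPoints
    smoothFunctions smoothFunctions_separatesPoints f hf ε hε
  exact ⟨g, g.2, hg⟩

/-- The inclusion of the smooth functions in `L²(𝕋)`. -/
noncomputable def smoothToL2 : smoothFunctions →ₗ[ℝ] L2Torus :=
  (ContinuousMap.toLp 2 (volume : Measure Torus) ℝ : C(Torus, ℝ) →L[ℝ] L2Torus).toLinearMap ∘ₗ
    smoothFunctions.val.toLinearMap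

theorem coeFn_smoothToL2 (f : smoothFunctions) :
    (smoothToL2 f : L2Torus) =ᵐ[volume] (f : C(Torus, ℝ)) :=
  ContinuousMap.coeFn_toLp volume (f : C(Torus, ℝ))

theorem denseRange_smoothToL2 : DenseRange smoothToL2 := by
  have h1 : DenseRange (Subtype.val : smoothFunctions → C(Torus, ℝ)) := by
    rw [denseRange_iff_closure_range, Subtype.range_coe, ← Subalgebra.topologicalClosure_coe,
      ContinuousMap.subalgebra_topologicalClosure_eq_top_of_separatesPoints _
        smoothFunctions_separatesPoints]
    rfl
  exact (ContinuousMap.toLp_denseRange ℝ (volume : Measure Torus) ℝ (p := 2) (by norm_num)).comp h1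
    (ContinuousLinearMap.continuous _)

theorem inner_smoothToL2 (u : L2Torus) (f : smoothFunctions) :
    inner ℝ u (smoothToL2 f) = ∫ x, u x * (f : C(Torus, ℝ)) x := by
  rw [L2.inner_def]
  refine integral_congr_ae ?_
  filter_upwards [coeFn_smoothToL2 f] with x hx
  rw [hx, real_inner_eq_re_inner, mul_comm]
  rfl

/-- The torus has mass one, so the variance of |f| is ‖f‖² - (∫|f|)², and a variance is nonnegative.
-/
theorem integral_abs_le_norm_smoothToL2 (f : smoothFunctions) :
    ∫ x, |(f : C(Torus, ℝ)) x| ≤ ‖smoothToL2 f‖ := by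
  have hc : Continuous fun x => |(f : C(Torus, ℝ)) x| := (f : C(Torus, ℝ)).continuous.abs
  have hi : Integrable (fun x => |(f : C(Torus, ℝ)) x|) volume :=
    hc.integrable_of_hasCompactSupport (HasCompactSupport.of_compactSpace _)
  have h2i : Integrable (fun x => |(f : C(Torus, ℝ)) x| ^ 2) volume :=
    (hc.pow 2).integrable_of_hasCompactSupport (HasCompactSupport.of_compactSpace _)
  have h1 : ‖smoothToL2 f‖ ^ 2 = ∫ x, |(f : C(Torus, ℝ)) x| ^ 2 := by
    rw [← real_inner_self_eq_norm_sq, inner_smoothToL2]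
    refine integral_congr_ae ?_
    filter_upwards [coeFn_smoothToL2 f] with x hx
    rw [hx, sq_abs, sq]
  set m := ∫ x, |(f : C(Torus, ℝ)) x| with hm
  have h3 : 0 ≤ ∫ x, (|(f : C(Torus, ℝ)) x| - m) ^ 2 := integral_nonneg fun x => sq_nonneg _
  have h4 : ∫ x, (|(f : C(Torus, ℝ)) x| - m) ^ 2 = ‖smoothToL2 f‖ ^ 2 - m ^ 2 := by
    have : ∀ x, (|(f : C(Torus, ℝ)) x| - m) ^ 2 =
        |(f : C(Torus, ℝ)) x| ^ 2 - 2 * m * |(f : C(Torus, ℝ)) x| + m ^ 2 := fun x => by ring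
    simp only [this]
    have h5 : Integrable (fun x => |(f : C(Torus, ℝ)) x| ^ 2 - 2 * m * |(f : C(Torus, ℝ)) x|)
      (volume : Measure Torus) := h2i.sub (hi.const_mul _)
    rw [integral_add h5 (integrable_const _), integral_sub h2i (hi.const_mul _),
      integral_const_mul, h1, ← hm, integral_const, torus_measureReal_univ]
    simp only [smul_eq_mul, one_mul]
    ring
  exact abs_le_of_sq_le_sq' (by linarith) (norm_nonneg _) |>.2

/-- A mean-zero smooth function has a smooth primitive, bounded by the `L¹` norm. -/
theorem exists_primitive {f : Torus → ℝ} (hf : SmoothOnTorus f) (h0 : ∫ x, f x = 0) :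
    ∃ F : Torus → ℝ, SmoothOnTorus F ∧ dh F = f ∧ ∀ x, |F x| ≤ ∫ y, |f y| := by
  set G : ℝ → ℝ := fun t => ∫ s in (0 : ℝ)..t, f (s : Torus) with hG
  have hc : Continuous fun s : ℝ => f (s : Torus) := ContDiff.continuous hf
  have hi : ∀ a b : ℝ, IntervalIntegrable (fun s : ℝ => f (s : Torus)) volume a b :=
    fun a b => hc.intervalIntegrable a b
  -- Mean zero is exactly what makes the primitive periodic.
  have hper : Function.Periodic G 1 := fun t => by
    simp only [hG]
    rw [← intervalIntegral.integral_add_adjacent_intervals (hi 0 t) (hi t (t + 1)),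
      UnitAddCircle.intervalIntegral_preimage t f, h0, add_zero]
  have hd : ∀ t : ℝ, HasDerivAt G (f (t : Torus)) t := fun t =>
    (hc.integral_hasStrictDerivAt 0 t).hasDerivAt
  have hlift : (fun s : ℝ => (hper.lift : Torus → ℝ) (s : Torus)) = G :=
    funext fun s => hper.lift_coe s
  refine ⟨hper.lift, ?_, ?_, ?_⟩
  · unfold SmoothOnTorus
    rw [hlift, contDiff_infty_iff_deriv]
    exact ⟨fun t => (hd t).differentiableAt, by rw [funext fun t => (hd t).deriv]; exact hf⟩
  · funext x
    induction x using QuotientAddGroup.induction_on with | H t =>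
    rw [dh_coe, hlift]
    exact (hd t).deriv
  · intro x
    obtain ⟨t, ht, rfl⟩ : ∃ t ∈ Ico (0 : ℝ) 1, (t : Torus) = x := by
      have := (AddCircle.coe_image_Ico_eq (1 : ℝ) 0).symm ▸ mem_univ x
      simpa using this
    have hla : (hper.lift : Torus → ℝ) (t : Torus) = G t := hper.lift_coe t
    rw [hla, ← UnitAddCircle.intervalIntegral_preimage 0 (fun y => |f y|), zero_add]
    refine (intervalIntegral.abs_integral_le_integral_abs ht.1).trans ?_
    exact intervalIntegral.integral_mono_interval le_rfl ht.1 ht.2.le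
      (Eventually.of_forall fun _ => abs_nonneg _) (hc.abs.intervalIntegrable 0 1)

theorem SmoothOnTorus.integrable {f : Torus → ℝ} (hf : SmoothOnTorus f) :
    Integrable f (volume : Measure Torus) :=
  hf.continuous.integrable_of_hasCompactSupport (HasCompactSupport.of_compactSpace f)

/-- Primitive of a smooth function minus its mean. -/
theorem exists_primitive_sub_mean {f : Torus → ℝ} (hf : SmoothOnTorus f) :
    ∃ F : Torus → ℝ, SmoothOnTorus F ∧ dh F = (fun x => f x - ∫ y, f y) ∧
      ∀ x, |F x| ≤ 2 * ∫ y, |f y| := by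
  set m := ∫ y, f y with hm
  obtain ⟨F, h1, h2, h3⟩ := exists_primitive (hf.sub (smoothOnTorus_const m)) (by
    rw [integral_sub hf.integrable (integrable_const _), integral_const,
      torus_measureReal_univ, one_smul, sub_self])
  refine ⟨F, h1, h2, fun x => (h3 x).trans ?_⟩
  calc ∫ y, |f y - m| ≤ ∫ y, (|f y| + |m|) := by
        refine integral_mono (hf.sub (smoothOnTorus_const m)).integrable.abs
          (hf.integrable.abs.add (integrable_const _)) fun y => abs_sub _ _
    _ = (∫ y, |f y|) + |m| := by
        rw [integral_add hf.integrable.abs (integrable_const _), integral_const,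
          torus_measureReal_univ, one_smul]
    _ ≤ _ := by
        have := abs_integral_le_integral_abs (f := f) (μ := (volume : Measure Torus))
        linarith

end SmoothFunctions

end ThinFilm

/-! ### Measures as second derivatives; the Poincaré inequality. -/

namespace ThinFilm

section SecondDerivative

open Filter Topology

theorem abs_integral_signedMeasure_le {f : Torus → ℝ} {A : ℝ} (hf : ∀ x, |f x| ≤ A)
    (σ : SignedMeasure Torus) :
    |∫ᵛ x, f x ∂<•σ| ≤ A * σ.totalVariation.real univ := by
  have hA : 0 ≤ A := (abs_nonneg _).trans (hf 0)
  have hfin : IsFiniteMeasure σ.variation := by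
    rw [← SignedMeasure.totalVariation_eq_variation]; infer_instance
  have h := VectorMeasure.norm_integral_le_of_norm_le_const (μ := σ)
    (B := (ContinuousLinearMap.lsmul ℝ ℝ).flip) (f := f) (Eventually.of_forall hf)
  rw [← SignedMeasure.totalVariation_eq_variation] at h
  refine h.trans (mul_le_mul_of_nonneg_right ?_ measureReal_nonneg)
  have : ‖(ContinuousLinearMap.lsmul ℝ ℝ : ℝ →L[ℝ] ℝ →L[ℝ] ℝ).flip‖ ≤ 1 := by
    rw [ContinuousLinearMap.opNorm_flip]
    exact ContinuousLinearMap.opNorm_lsmul_le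
  nlinarith

theorem integrable_signedMeasure {f : Torus → ℝ} (hf : Continuous f) (σ : SignedMeasure Torus) :
    σ.Integrable f := by
  unfold VectorMeasure.Integrable
  rw [← SignedMeasure.totalVariation_eq_variation]
  exact hf.integrable_of_hasCompactSupport (HasCompactSupport.of_compactSpace f)

theorem integrable_of_continuous {f : Torus → ℝ} (hf : Continuous f) (μ : Measure Torus)
    [IsFiniteMeasure μ] : Integrable f μ :=
  hf.integrable_of_hasCompactSupport (HasCompactSupport.of_compactSpace f)

theorem integral_toSignedMeasure_sub {f : Torus → ℝ} (hf : Continuous f) (μ ν : Measure Torus)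
    [IsFiniteMeasure μ] [IsFiniteMeasure ν] :
    ∫ᵛ x, f x ∂<•(μ.toSignedMeasure - ν.toSignedMeasure) = ∫ x, f x ∂μ - ∫ x, f x ∂ν := by
  rw [VectorMeasure.integral_sub_vectorMeasure (integrable_signedMeasure hf _)
    (integrable_signedMeasure hf _), VectorMeasure.integral_toSignedMeasure,
    VectorMeasure.integral_toSignedMeasure]

/-- A signed measure on the torus is determined by its integrals of smooth functions. -/
theorem signedMeasure_ext_of_smooth {σ τ : SignedMeasure Torus}
    (h : ∀ f : Torus → ℝ, SmoothOnTorus f → ∫ᵛ x, f x ∂<•σ = ∫ᵛ x, f x ∂<•τ) : σ = τ := by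
  rw [← sub_eq_zero]
  set ρ := σ - τ with hρ
  have h0 : ∀ f : Torus → ℝ, SmoothOnTorus f → ∫ᵛ x, f x ∂<•ρ = 0 := fun f hf => by
    rw [hρ, VectorMeasure.integral_sub_vectorMeasure (hf.integrable_signed σ)
      (hf.integrable_signed τ), h f hf, sub_self]
  have h1 : ∀ f : Torus → ℝ, Continuous f → ∫ᵛ x, f x ∂<•ρ = 0 := fun f hf => by
    by_contra hne
    have hpos : 0 < |∫ᵛ x, f x ∂<•ρ| := abs_pos.2 hne
    set V := ρ.totalVariation.real univ
    have hV : 0 ≤ V := measureReal_nonneg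
    obtain ⟨g, hg, hgf⟩ := exists_smooth_near hf
      (show 0 < |∫ᵛ x, f x ∂<•ρ| / (V + 1) by positivity)
    have h2 := abs_integral_signedMeasure_le (f := fun x => g x - f x) (fun x => (hgf x).le) ρ
    rw [VectorMeasure.integral_fun_sub (hg.integrable_signed ρ) (integrable_signedMeasure hf ρ),
      h0 g hg, zero_sub, abs_neg] at h2
    have h3 : |∫ᵛ x, f x ∂<•ρ| / (V + 1) * V < |∫ᵛ x, f x ∂<•ρ| := by
      rw [div_mul_eq_mul_div, div_lt_iff₀ (by positivity)]
      nlinarith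
    exact absurd h2 (not_le.2 h3)
  have hj := ρ.toSignedMeasure_toJordanDecomposition
  set j := ρ.toJordanDecomposition
  have h2 : j.posPart = j.negPart := by
    refine ext_of_forall_integral_eq_of_IsFiniteMeasure fun f => ?_
    have := h1 f f.continuous
    rw [← hj, JordanDecomposition.toSignedMeasure,
      integral_toSignedMeasure_sub f.continuous] at this
    exact sub_eq_zero.1 this
  rw [← hj, JordanDecomposition.toSignedMeasure, sub_eq_zero]
  ext s hs
  simp [Measure.toSignedMeasure_apply_measurable hs, h2]

theorem IsSecondDeriv.unique {u : L2Torus} {σ τ : SignedMeasure Torus} (hσ : IsSecondDeriv u σ)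
    (hτ : IsSecondDeriv u τ) : σ = τ :=
  signedMeasure_ext_of_smooth fun f hf => (hσ f hf).symm.trans (hτ f hf)

theorem hh_eq {u : USpace} {σ : SignedMeasure Torus} (h : IsSecondDeriv (u : L2Torus) σ) :
    hh u = σ := by
  have hex : ∃ μ, IsSecondDeriv (u : L2Torus) μ := ⟨σ, h⟩
  rw [hh, dif_pos hex]
  exact hex.choose_spec.unique h

/-- A function whose second derivative is a measure belongs to `W^{1,2}`. -/
theorem IsSecondDeriv.memW12 {u : L2Torus} {σ : SignedMeasure Torus} (h : IsSecondDeriv u σ) :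
    MemW12 u := by
  have hint : ∀ f : smoothFunctions, SmoothOnTorus (f : C(Torus, ℝ)) := fun f => f.2
  let ℓ : smoothFunctions →ₗ[ℝ] ℝ :=
    { toFun := fun f => ∫ x, u x * dh (f : C(Torus, ℝ)) x
      map_add' := fun f g => by
        rw [← integral_add ((hint f).dh.integrable_mul u) ((hint g).dh.integrable_mul u)]
        refine integral_congr_ae (Eventually.of_forall fun x => ?_)
        have := congrFun ((hint f).dh_add (hint g)) x
        change u x * dh (fun x => (f : C(Torus, ℝ)) x + (g : C(Torus, ℝ)) x) x = _
        rw [this]; ring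
      map_smul' := fun c f => by
        rw [RingHom.id_apply, smul_eq_mul, ← integral_const_mul]
        refine integral_congr_ae (Eventually.of_forall fun x => ?_)
        have := congrFun ((hint f).dh_const_mul c) x
        change u x * dh (fun x => c * (f : C(Torus, ℝ)) x) x = _
        rw [this]; ring }
  -- With F a primitive of f minus its mean, the pairing of u with f_h = F_hh equals ∫ F dσ, and |F|
  -- ≤ 2‖f‖. So ℓ extends to L², and its Riesz representative is minus the derivative of u.
  have hb : ∃ C, ∀ f, ‖ℓ f‖ ≤ C * ‖smoothToL2 f‖ := by
    refine ⟨2 * σ.totalVariation.real univ, fun f => ?_⟩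
    obtain ⟨F, h1, h2, h3⟩ := exists_primitive_sub_mean (hint f)
    have h4 : ℓ f = ∫ᵛ x, F x ∂<•σ := by
      rw [← h F h1, h2, SmoothOnTorus.dh_sub_const]
      rfl
    rw [h4]
    refine (abs_integral_signedMeasure_le h3 σ).trans ?_
    have := mul_le_mul_of_nonneg_right (integral_abs_le_norm_smoothToL2 f)
      (measureReal_nonneg (μ := σ.totalVariation) (s := univ))
    linarith
  refine ⟨-(InnerProductSpace.toDual ℝ L2Torus).symm (ℓ.extendOfNorm smoothToL2), fun f hf => ?_⟩
  have h1 := LinearMap.extendOfNorm_eq denseRange_smoothToL2 hb (⟨⟨f, hf.continuous⟩, hf⟩ : smoothFunctions)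
  rw [← InnerProductSpace.toDual_symm_apply (𝕜 := ℝ), inner_smoothToL2] at h1
  have h2 : (fun x => ((-(InnerProductSpace.toDual ℝ L2Torus).symm (ℓ.extendOfNorm smoothToL2) :
      L2Torus) : Torus → ℝ) x * f x) =ᵐ[volume] fun x =>
      -((((InnerProductSpace.toDual ℝ L2Torus).symm (ℓ.extendOfNorm smoothToL2) : L2Torus)
        : Torus → ℝ) x * f x) := by
    filter_upwards [Lp.coeFn_neg
      ((InnerProductSpace.toDual ℝ L2Torus).symm (ℓ.extendOfNorm smoothToL2))] with x hx
    rw [hx, Pi.neg_apply, neg_mul]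
  rw [integral_congr_ae h2, integral_neg, neg_neg]
  exact h1.symm

theorem mem_VTilde_of_isSecondDeriv {u : USpace} {σ : SignedMeasure Torus}
    (h : IsSecondDeriv (u : L2Torus) σ) : u ∈ VTilde := ⟨h.memW12, σ, h⟩

/-- The Poincaré inequality `‖v‖_U ≤ 4 ‖v‖_Ṽ`. -/
theorem norm_le_normV {v : USpace} (hv : v ∈ VTilde) : ‖v‖ ≤ 4 * normV v := by
  have hσ := hh_spec hv
  set σ := hh v
  have hn : normV v = σ.totalVariation.real univ := rfl
  have hn0 : 0 ≤ normV v := measureReal_nonneg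
  have hmean : ∫ x, (v : L2Torus) x = 0 := v.2
  -- Integrating f minus its mean twice, again subtracting the mean, gives G with G_hh = f minus a
  -- constant, which v does not see because its mean is zero. Each integration costs a factor 2,
  -- hence the 4.
  have h1 : ∀ f : smoothFunctions, inner ℝ (v : L2Torus) (smoothToL2 f) ≤
      4 * normV v * ‖smoothToL2 f‖ := by
    intro f
    have hf : SmoothOnTorus (f : C(Torus, ℝ)) := f.2
    obtain ⟨F, h1, h2, h3⟩ := exists_primitive_sub_mean hf
    obtain ⟨G, h4, h5, h6⟩ := exists_primitive_sub_mean h1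
    have h7 : dh (dh G) = fun x => (f : C(Torus, ℝ)) x - ∫ y, (f : C(Torus, ℝ)) y := by
      rw [h5, SmoothOnTorus.dh_sub_const, h2]
    have h8 := hσ G h4
    rw [h7] at h8
    simp only [mul_sub] at h8
    rw [integral_sub (hf.integrable_mul _)
      ((smoothOnTorus_const _).integrable_mul (v : L2Torus)), integral_mul_const, hmean, zero_mul,
      sub_zero] at h8
    rw [inner_smoothToL2, h8]
    have h9 : ∀ x, |G x| ≤ 4 * ‖smoothToL2 f‖ := fun x => by
      refine (h6 x).trans ?_
      have h10 : ∫ y, |F y| ≤ 2 * ‖smoothToL2 f‖ := by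
        calc ∫ y, |F y| ≤ ∫ _ : Torus, 2 * ‖smoothToL2 f‖ := by
              refine integral_mono h1.integrable.abs (integrable_const _) fun y => ?_
              exact (h3 y).trans (mul_le_mul_of_nonneg_left (integral_abs_le_norm_smoothToL2 f)
                zero_le_two)
          _ = _ := by rw [integral_const, torus_measureReal_univ, one_smul]
      linarith
    have := (le_abs_self _).trans (abs_integral_signedMeasure_le h9 σ)
    rw [hn]
    linarith
  have h2 : ∀ u : L2Torus, inner ℝ (v : L2Torus) u ≤ 4 * normV v * ‖u‖ := fun u =>
    denseRange_smoothToL2.induction_on (p := fun u => inner ℝ (v : L2Torus) u ≤ 4 * normV v * ‖u‖)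
      u (isClosed_le (by fun_prop) (by fun_prop)) h1
  have h3 := h2 v
  rw [real_inner_self_eq_norm_sq] at h3
  change ‖(v : L2Torus)‖ ≤ _
  by_contra hc
  push Not at hc
  nlinarith [norm_nonneg (v : L2Torus)]

end SecondDerivative

end ThinFilm

/-! ### Duality formulas for the total variation and for φ. -/

namespace ThinFilm

section Duality

open Filter Topology

/-- Bounded measurable functions are almost everywhere limits of continuous functions with values
in the same interval. -/
theorem exists_seq_continuous_tendsto_ae (m : Measure Torus) [IsFiniteMeasure m] {g : Torus → ℝ}
    (hg : Measurable g) {a b : ℝ} (hgab : ∀ x, g x ∈ Icc a b) :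
    ∃ f : ℕ → Torus → ℝ, (∀ n, Continuous (f n)) ∧ (∀ n x, f n x ∈ Icc a b) ∧
      ∀ᵐ x ∂m, Tendsto (fun n => f n x) atTop (𝓝 (g x)) := by
  have hab : a ≤ b := (hgab 0).1.trans (hgab 0).2
  have hmem : MemLp g 1 m := by
    refine MemLp.of_bound hg.aestronglyMeasurable (max |a| |b|) (Eventually.of_forall fun x => ?_)
    exact abs_le_max_abs_abs (hgab x).1 (hgab x).2
  have hex : ∀ n : ℕ, ∃ f : BoundedContinuousFunction Torus ℝ,
      eLpNorm (g - (f : Torus → ℝ)) 1 m ≤ ((n : ℝ≥0∞) + 1)⁻¹ := fun n =>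
    (hmem.exists_boundedContinuous_eLpNorm_sub_le ENNReal.one_ne_top
      (ε := ((n : ℝ≥0∞) + 1)⁻¹) (ENNReal.inv_ne_zero.2 (by finiteness))).imp fun _ h => h.1
  choose f hf using hex
  have hlim : Tendsto (fun n => eLpNorm ((f n : Torus → ℝ) - g) 1 m) atTop (𝓝 0) := by
    have h0 : Tendsto (fun n : ℕ => ((n : ℝ≥0∞) + 1)⁻¹) atTop (𝓝 0) := by
      have := (tendsto_add_atTop_iff_nat 1).2 ENNReal.tendsto_inv_nat_nhds_zero
      simpa using this
    refine tendsto_of_tendsto_of_tendsto_of_le_of_le tendsto_const_nhds h0 (fun _ => zero_le)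
      fun n => ?_
    rw [eLpNorm_sub_comm]
    exact hf n
  have hmeas := tendstoInMeasure_of_tendsto_eLpNorm one_ne_zero
    (fun n => (f n).continuous.aestronglyMeasurable) hg.aestronglyMeasurable hlim
  obtain ⟨ns, -, hns⟩ := hmeas.exists_seq_tendsto_ae
  -- Clipping to [a, b] keeps the limit because g already takes its values there.
  refine ⟨fun n x => max a (min b (f (ns n) x)), fun n => ?_, fun n x => ?_, ?_⟩
  · exact continuous_const.max (continuous_const.min (f (ns n)).continuous)
  · exact ⟨le_max_left _ _, max_le hab (min_le_left _ _)⟩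
  · filter_upwards [hns] with x hx
    have h1 : g x = max a (min b (g x)) := by
      rw [min_eq_right (hgab x).2, max_eq_right (hgab x).1]
    rw [h1]
    exact tendsto_const_nhds.max (tendsto_const_nhds.min hx)

theorem tendsto_integral_of_bounded (m : Measure Torus) [IsFiniteMeasure m] {f : ℕ → Torus → ℝ}
    {g : Torus → ℝ} {A : ℝ} (hf : ∀ n, Continuous (f n)) (hb : ∀ n x, |f n x| ≤ A)
    (hlim : ∀ᵐ x ∂m, Tendsto (fun n => f n x) atTop (𝓝 (g x))) :
    Tendsto (fun n => ∫ x, f n x ∂m) atTop (𝓝 (∫ x, g x ∂m)) :=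
  tendsto_integral_of_dominated_convergence (fun _ => A)
    (fun n => (hf n).aestronglyMeasurable) (integrable_const A)
    (fun n => Eventually.of_forall (hb n)) hlim

/-- Duality formula for the total variation. -/
theorem totalVariation_le_iff {σ : SignedMeasure Torus} {C : ℝ} :
    σ.totalVariation.real univ ≤ C ↔
      ∀ f : Torus → ℝ, Continuous f → (∀ x, |f x| ≤ 1) → ∫ᵛ x, f x ∂<•σ ≤ C := by
  constructor
  · intro h f _ hf1
    have := (le_abs_self _).trans (abs_integral_signedMeasure_le hf1 σ)
    linarith
  · intro h
    have hj := σ.toSignedMeasure_toJordanDecomposition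
    set j := σ.toJordanDecomposition with hjdef
    obtain ⟨S, hS, hSp, hSn⟩ := j.mutuallySingular
    classical
    -- The sign of the Hahn decomposition attains the total variation. Approximating it almost
    -- everywhere for the sum of the two Jordan parts handles both at once.
    set f₀ : Torus → ℝ := fun x => if x ∈ S then -1 else 1 with hf₀
    have hf₀m : Measurable f₀ := Measurable.ite hS measurable_const measurable_const
    obtain ⟨f, hfc, hfb, hfl⟩ := exists_seq_continuous_tendsto_ae (j.posPart + j.negPart) hf₀m
      (a := -1) (b := 1) (fun x => by
        simp only [hf₀]; split_ifs <;> constructor <;> norm_num)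
    have hfb' : ∀ n x, |f n x| ≤ 1 := fun n x => abs_le.2 (hfb n x)
    rw [ae_add_measure_iff] at hfl
    have h1 := tendsto_integral_of_bounded j.posPart hfc hfb' hfl.1
    have h2 := tendsto_integral_of_bounded j.negPart hfc hfb' hfl.2
    have e1 : ∫ x, f₀ x ∂j.posPart = j.posPart.real univ := by
      have : f₀ =ᵐ[j.posPart] fun _ => 1 := by
        filter_upwards [measure_eq_zero_iff_ae_notMem.1 hSp] with x hx
        simp [hf₀, hx]
      rw [integral_congr_ae this]; simp
    have e2 : ∫ x, f₀ x ∂j.negPart = -j.negPart.real univ := by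
      have : f₀ =ᵐ[j.negPart] fun _ => -1 := by
        filter_upwards [measure_eq_zero_iff_ae_notMem.1 hSn] with x hx
        simp only [mem_compl_iff, not_not] at hx
        simp [hf₀, hx]
      rw [integral_congr_ae this]; simp
    have e3 : σ.totalVariation.real univ = j.posPart.real univ + j.negPart.real univ := by
      rw [SignedMeasure.totalVariation, measureReal_add_apply]
    rw [e3]
    have h3 := h1.sub h2
    rw [e1, e2, sub_neg_eq_add] at h3
    refine le_of_tendsto' h3 fun n => ?_
    have := h (f n) (hfc n) (hfb' n)
    rwa [← hj, JordanDecomposition.toSignedMeasure,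
      integral_toSignedMeasure_sub (hfc n)] at this

theorem measurable_Phi : Measurable Phi := by
  unfold Phi
  exact Measurable.ite measurableSet_Iic measurable_const (by fun_prop)

/-- For x > 0 this is (1 - bx)²(1 + 2bx) ≥ 0 divided by 2x², with equality at b = 1/x. -/
theorem ofReal_le_Phi {b x : ℝ} (hb : 0 ≤ b) :
    ENNReal.ofReal (3 / 2 * b ^ 2 - b ^ 3 * x) ≤ Phi x := by
  unfold Phi
  split_ifs with hx
  · exact le_top
  · push Not at hx
    refine ENNReal.ofReal_le_ofReal ?_
    rw [inv_eq_one_div, div_div, le_div_iff₀ (by positivity)]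
    nlinarith [mul_nonneg (sq_nonneg (1 - b * x)) (by positivity : 0 ≤ 1 + 2 * (b * x))]

theorem integral_le_toReal_lintegral {α : Type*} [MeasurableSpace α] {m : Measure α} {f : α → ℝ}
    (hf : Integrable f m) : ∫ x, f x ∂m ≤ (∫⁻ x, ENNReal.ofReal (f x) ∂m).toReal := by
  rw [integral_eq_lintegral_pos_part_sub_lintegral_neg_part hf]
  exact sub_le_self _ ENNReal.toReal_nonneg

/-- Duality formula for the functional `μ ↦ ∫ Φ(dμ/dx)`. -/
theorem lintegral_Phi_le_iff (μ : Measure Torus) [IsFiniteMeasure μ] {K : ℝ} (hK : 0 ≤ K) :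
    ∫⁻ x, Phi (μ.rnDeriv volume x).toReal ≤ ENNReal.ofReal K ↔
      ∀ g : Torus → ℝ, Continuous g → (∀ x, 0 ≤ g x) →
        (∫ x, 3 / 2 * g x ^ 2) - ∫ x, g x ^ 3 ∂μ ≤ K := by
  set ρ : Torus → ℝ := fun x => (μ.rnDeriv volume x).toReal with hρ
  have hρm : Measurable ρ := (Measure.measurable_rnDeriv μ volume).ennreal_toReal
  have hρ0 : ∀ x, 0 ≤ ρ x := fun x => ENNReal.toReal_nonneg
  have hρi : Integrable ρ volume := Measure.integrable_toReal_rnDeriv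
  have hfin : ∀ᵐ x, μ.rnDeriv (volume : Measure Torus) x < ⊤ := Measure.rnDeriv_lt_top μ volume
  have hdens : ∀ f : Torus → ℝ,
      ∫ x, f x ∂(volume : Measure Torus).withDensity (μ.rnDeriv volume) = ∫ x, f x * ρ x := fun f => by
    rw [integral_withDensity_eq_integral_toReal_smul (Measure.measurable_rnDeriv _ _) hfin]
    refine integral_congr_ae (Eventually.of_forall fun x => ?_)
    simp only [smul_eq_mul, hρ, mul_comm]
  constructor
  · intro h g hg hg0
    have hg3 : Continuous fun x => g x ^ 3 := hg.pow 3
    -- As g ≥ 0, the singular part of μ can only increase the integral of g³.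
    have h1 : ∫ x, g x ^ 3 * ρ x ≤ ∫ x, g x ^ 3 ∂μ := by
      rw [← hdens]
      exact integral_mono_measure (Measure.withDensity_rnDeriv_le μ volume)
        (Eventually.of_forall fun x => pow_nonneg (hg0 x) 3) (integrable_of_continuous hg3 μ)
    obtain ⟨A, hA⟩ := isCompact_univ.exists_bound_of_continuousOn hg3.continuousOn
    have hi : Integrable (fun x => g x ^ 3 * ρ x) volume :=
      hρi.bdd_mul hg3.aestronglyMeasurable (Eventually.of_forall fun x => hA x (mem_univ x))
    have hi2 : Integrable (fun x => 3 / 2 * g x ^ 2) (volume : Measure Torus) :=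
      integrable_of_continuous (continuous_const.mul (hg.pow 2)) _
    have h2 : ∫ x, (3 / 2 * g x ^ 2 - g x ^ 3 * ρ x) ≤ K := by
      refine (integral_le_toReal_lintegral (hi2.sub hi)).trans ?_
      refine ENNReal.toReal_le_of_le_ofReal hK (le_trans (lintegral_mono fun x => ?_) h)
      exact ofReal_le_Phi (hg0 x)
    rw [integral_sub hi2 hi] at h2
    linarith
  · intro h
    obtain ⟨S, hS, hS1, hS2⟩ := Measure.mutuallySingular_singularPart μ (volume : Measure Torus)
    -- The optimal test function 1/ρ, truncated at height n + 1. Since bρ ≤ 1, the integrand 3b²/2 -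
    -- b³ρ is at least b²/2, which increases to Φ(ρ).
    set b : ℕ → Torus → ℝ := fun n x => (max (1 / ((n : ℝ) + 1)) (ρ x))⁻¹ with hb
    have hpos : ∀ (n : ℕ) x, 0 < max (1 / ((n : ℝ) + 1)) (ρ x) := fun n x =>
      lt_max_of_lt_left (by positivity)
    have hb0 : ∀ (n : ℕ) x, 0 ≤ b n x := fun n x => inv_nonneg.2 (hpos n x).le
    have hbn : ∀ (n : ℕ) x, b n x ≤ n + 1 := fun n x => by
      have := inv_anti₀ (by positivity) (le_max_left (1 / ((n : ℝ) + 1)) (ρ x))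
      simpa [hb] using this
    have hbρ : ∀ n x, b n x * ρ x ≤ 1 := fun n x => by
      simp only [hb]
      rw [inv_mul_le_iff₀ (hpos n x), mul_one]
      exact le_max_right _ _
    have hbm : ∀ n, Measurable (b n) := fun n => (measurable_const.max hρm).inv
    -- S has full Lebesgue measure and is null for the singular part of μ, so the cut-off changes
    -- nothing for Lebesgue measure and removes the singular part.
    set c : ℕ → Torus → ℝ := fun n => S.indicator (b n) with hc
    have hcm : ∀ n, Measurable (c n) := fun n => (hbm n).indicator hS
    have hc0 : ∀ n x, 0 ≤ c n x := fun n x => indicator_nonneg (fun x _ => hb0 n x) x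
    have hcn : ∀ (n : ℕ) x, c n x ≤ n + 1 := fun n x => by
      by_cases hx : x ∈ S
      · simpa only [hc, indicator_of_mem hx] using hbn n x
      · simp only [hc, indicator_of_notMem hx]
        positivity
    have hvol : ∀ n, c n =ᵐ[volume] b n := fun n => by
      filter_upwards [measure_eq_zero_iff_ae_notMem.1 hS2] with x hx
      exact indicator_of_mem (not_not.1 hx) _
    have hsing : ∀ n, c n =ᵐ[μ.singularPart volume] 0 := fun n => by
      filter_upwards [measure_eq_zero_iff_ae_notMem.1 hS1] with x hx
      exact indicator_of_notMem hx _
    have hK1 : ∀ n, (∫ x, 3 / 2 * c n x ^ 2) - ∫ x, c n x ^ 3 ∂μ ≤ K := by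
      intro n
      obtain ⟨f, hfc, hfb, hfl⟩ := exists_seq_continuous_tendsto_ae (volume + μ) (hcm n)
        (a := 0) (b := (n : ℝ) + 1) (fun x => ⟨hc0 n x, hcn n x⟩)
      rw [ae_add_measure_iff] at hfl
      have h1 := tendsto_integral_of_bounded volume (f := fun k x => 3 / 2 * f k x ^ 2)
        (g := fun x => 3 / 2 * c n x ^ 2) (A := 3 / 2 * ((n : ℝ) + 1) ^ 2)
        (fun k => continuous_const.mul ((hfc k).pow 2)) (fun k x => by
          rw [abs_of_nonneg (by positivity)]
          have := pow_le_pow_left₀ (hfb k x).1 (hfb k x).2 2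
          linarith) (by
          filter_upwards [hfl.1] with x hx using (hx.pow 2).const_mul _)
      have h2 := tendsto_integral_of_bounded μ (f := fun k x => f k x ^ 3)
        (g := fun x => c n x ^ 3) (A := ((n : ℝ) + 1) ^ 3)
        (fun k => (hfc k).pow 3) (fun k x => by
          rw [abs_of_nonneg (pow_nonneg (hfb k x).1 3)]
          exact pow_le_pow_left₀ (hfb k x).1 (hfb k x).2 3) (by
          filter_upwards [hfl.2] with x hx using hx.pow 3)
      exact le_of_tendsto' (h1.sub h2) fun k => h (f k) (hfc k) fun x => (hfb k x).1
    have hK2 : ∀ n, ∫⁻ x, ENNReal.ofReal (b n x ^ 2 / 2) ≤ ENNReal.ofReal K := by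
      intro n
      have hbd : ∀ x, ‖b n x‖ ≤ n + 1 := fun x => by
        rw [Real.norm_of_nonneg (hb0 n x)]; exact hbn n x
      have hi1 : Integrable (fun x => b n x ^ 2) volume := by
        refine Integrable.of_bound ((hbm n).pow_const 2).aestronglyMeasurable (((n : ℝ) + 1) ^ 2)
          (Eventually.of_forall fun x => ?_)
        rw [norm_pow]
        exact pow_le_pow_left₀ (norm_nonneg _) (hbd x) 2
      have hi2 : Integrable (fun x => b n x ^ 3 * ρ x) volume := by
        refine hρi.bdd_mul ((hbm n).pow_const 3).aestronglyMeasurable (c := ((n : ℝ) + 1) ^ 3)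
          (Eventually.of_forall fun x => ?_)
        rw [norm_pow]
        exact pow_le_pow_left₀ (norm_nonneg _) (hbd x) 3
      have hi3 : ∀ m : Measure Torus, IsFiniteMeasure m → Integrable (fun x => c n x ^ 3) m :=
        fun m _ => by
        refine Integrable.of_bound ((hcm n).pow_const 3).aestronglyMeasurable (((n : ℝ) + 1) ^ 3)
          (Eventually.of_forall fun x => ?_)
        rw [Real.norm_of_nonneg (pow_nonneg (hc0 n x) 3)]
        exact pow_le_pow_left₀ (hc0 n x) (hcn n x) 3
      have e1 : ∫ x, c n x ^ 3 ∂μ = ∫ x, b n x ^ 3 * ρ x := by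
        have hdec : ∫ x, c n x ^ 3 ∂μ = ∫ x, c n x ^ 3 ∂(μ.singularPart volume +
            (volume : Measure Torus).withDensity (μ.rnDeriv volume)) := by
          rw [Measure.singularPart_add_rnDeriv]
        have hfin2 : IsFiniteMeasure ((volume : Measure Torus).withDensity (μ.rnDeriv volume)) :=
          inferInstance
        rw [hdec, integral_add_measure (hi3 _ inferInstance) (hi3 _ hfin2), hdens]
        have : ∫ x, c n x ^ 3 ∂μ.singularPart volume = 0 := by
          refine integral_eq_zero_of_ae ?_
          filter_upwards [hsing n] with x hx
          simp [hx]
        rw [this, zero_add]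
        refine integral_congr_ae ?_
        filter_upwards [hvol n] with x hx
        rw [hx]
      have e2 : ∫ x, 3 / 2 * c n x ^ 2 = ∫ x, 3 / 2 * b n x ^ 2 := by
        refine integral_congr_ae ?_
        filter_upwards [hvol n] with x hx
        rw [hx]
      have h1 := hK1 n
      rw [e1, e2, ← integral_sub (hi1.const_mul _) hi2] at h1
      have h2 : ∫ x, b n x ^ 2 / 2 ≤ ∫ x, (3 / 2 * b n x ^ 2 - b n x ^ 3 * ρ x) := by
        refine integral_mono (hi1.div_const 2) ((hi1.const_mul _).sub hi2) fun x => ?_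
        have := mul_le_mul_of_nonneg_left (hbρ n x) (sq_nonneg (b n x))
        simp only
        nlinarith
      rw [← ofReal_integral_eq_lintegral_ofReal (hi1.div_const 2)
        (Eventually.of_forall fun x => by positivity)]
      exact ENNReal.ofReal_le_ofReal (h2.trans h1)
    have hlim : ∀ x, Tendsto (fun n => ENNReal.ofReal (b n x ^ 2 / 2)) atTop (𝓝 (Phi (ρ x))) := by
      intro x
      unfold Phi
      split_ifs with hx
      · have hx0 : ρ x = 0 := le_antisymm hx (hρ0 x)
        have : ∀ n : ℕ, b n x = (n : ℝ) + 1 := fun n => by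
          simp only [hb, hx0]
          rw [max_eq_left (by positivity), one_div, inv_inv]
        simp only [this]
        refine ENNReal.tendsto_ofReal_atTop.comp ?_
        refine Tendsto.atTop_div_const two_pos ?_
        exact (tendsto_pow_atTop two_ne_zero).comp
          (tendsto_atTop_add_const_right _ _ tendsto_natCast_atTop_atTop)
      · push Not at hx
        refine (ENNReal.continuous_ofReal.tendsto _).comp ?_
        have h1 : Tendsto (fun n : ℕ => max (1 / ((n : ℝ) + 1)) (ρ x)) atTop (𝓝 (max 0 (ρ x))) :=
          tendsto_one_div_add_atTop_nhds_zero_nat.max tendsto_const_nhds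
        rw [max_eq_right hx.le] at h1
        have h2 := ((h1.inv₀ hx.ne').pow 2).div_const 2
        rwa [inv_pow] at h2
    calc ∫⁻ x, Phi (ρ x) = ∫⁻ x, liminf (fun n => ENNReal.ofReal (b n x ^ 2 / 2)) atTop :=
          lintegral_congr fun x => (hlim x).liminf_eq.symm
      _ ≤ liminf (fun n => ∫⁻ x, ENNReal.ofReal (b n x ^ 2 / 2)) atTop :=
          lintegral_liminf_le fun n => (((hbm n).pow_const 2).div_const 2).ennreal_ofReal
      _ ≤ ENNReal.ofReal K := by
          refine liminf_le_of_frequently_le' (Frequently.of_forall hK2)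

end Duality

end ThinFilm

/-! ### The positive measure w_hh + c₀ and the effective domain. -/

namespace ThinFilm

section Shift

open Filter Topology

/-- `μ = u_hh + c₀` as a positive measure. -/
def IsShiftedSecondDeriv (c₀ : ℝ) (u : USpace) (μ : FiniteMeasure Torus) : Prop :=
  ∀ f : Torus → ℝ, SmoothOnTorus f →
    ∫ x, (u : L2Torus) x * dh (dh f) x = (∫ x, f x ∂(μ : Measure Torus)) - c₀ * ∫ x, f x

theorem integral_shifted {f : Torus → ℝ} (hf : Continuous f) (c₀ : ℝ) (μ : FiniteMeasure Torus) :
    ∫ᵛ x, f x ∂<•((μ : Measure Torus).toSignedMeasure -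
        c₀ • (volume : Measure Torus).toSignedMeasure) =
      (∫ x, f x ∂(μ : Measure Torus)) - c₀ * ∫ x, f x := by
  rw [VectorMeasure.integral_sub_vectorMeasure (integrable_signedMeasure hf _)
    (integrable_signedMeasure hf _), VectorMeasure.integral_smul_vectorMeasure,
    VectorMeasure.integral_toSignedMeasure, VectorMeasure.integral_toSignedMeasure, smul_eq_mul]

namespace IsShiftedSecondDeriv

variable {c₀ : ℝ} {u : USpace} {μ : FiniteMeasure Torus}

theorem isSecondDeriv (h : IsShiftedSecondDeriv c₀ u μ) :
    IsSecondDeriv (u : L2Torus) ((μ : Measure Torus).toSignedMeasure -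
        c₀ • (volume : Measure Torus).toSignedMeasure) := fun f hf => by
  rw [h f hf, integral_shifted hf.continuous]

theorem mem_VTilde (h : IsShiftedSecondDeriv c₀ u μ) : u ∈ VTilde :=
  mem_VTilde_of_isSecondDeriv h.isSecondDeriv

theorem hh_eq (h : IsShiftedSecondDeriv c₀ u μ) : hh u = (μ : Measure Torus).toSignedMeasure -
    c₀ • (volume : Measure Torus).toSignedMeasure := ThinFilm.hh_eq h.isSecondDeriv

theorem posMeasure (h : IsShiftedSecondDeriv c₀ u μ) : PosMeasure c₀ u := by
  unfold PosMeasure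
  rw [h.hh_eq, sub_add_cancel]
  exact Measure.zero_le_toSignedMeasure _

theorem integral_hh (h : IsShiftedSecondDeriv c₀ u μ) {f : Torus → ℝ} (hf : Continuous f) :
    ∫ᵛ x, f x ∂<•(hh u) = (∫ x, f x ∂(μ : Measure Torus)) - c₀ * ∫ x, f x := by
  rw [h.hh_eq, integral_shifted hf]

/-- The constant 1 has zero second derivative. The mass does not depend on u, so all these measures
lie in one weakly compact set. -/
theorem measureReal_univ (h : IsShiftedSecondDeriv c₀ u μ) : (μ : Measure Torus).real univ = c₀ := by
  have h1 := h (fun _ => 1) (smoothOnTorus_const 1)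
  have h2 : dh (dh fun _ : Torus => (1 : ℝ)) = fun _ => 0 := by
    have h3 : dh (fun _ : Torus => (1 : ℝ)) = fun _ => 0 := by
      funext x; simp [dh]
    rw [h3]; funext x; simp [dh]
  rw [h2, integral_const, integral_const, torus_measureReal_univ] at h1
  simp only [mul_zero, integral_zero, smul_eq_mul, mul_one] at h1
  linarith

theorem normV_le_iff (h : IsShiftedSecondDeriv c₀ u μ) {C : ℝ} :
    normV u ≤ C ↔ ∀ f : Torus → ℝ, Continuous f → (∀ x, |f x| ≤ 1) →
      (∫ x, f x ∂(μ : Measure Torus)) - c₀ * ∫ x, f x ≤ C := by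
  rw [normV, totalVariation_le_iff]
  refine forall₃_congr fun f hf _ => ?_
  rw [h.integral_hh hf]

/-- Subtracting c₀ times Lebesgue measure leaves the singular part untouched, and the Lebesgue
decomposition is unique. -/
theorem acDensity_ae_eq (h : IsShiftedSecondDeriv c₀ u μ) :
    ∀ᵐ x, acDensity u x + c₀ = ((μ : Measure Torus).rnDeriv volume x).toReal := by
  set m := (μ : Measure Torus) with hm
  set f : Torus → ℝ := fun x => (m.rnDeriv volume x).toReal - c₀ with hf
  have hρ : Integrable (fun x => (m.rnDeriv volume x).toReal) (volume : Measure Torus) :=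
    Measure.integrable_toReal_rnDeriv
  have hfi : Integrable f volume := hρ.sub (integrable_const _)
  have hsing : (m.singularPart volume).toSignedMeasure ⟂ᵥ
      (volume : Measure Torus).toENNRealVectorMeasure := by
    obtain ⟨S, hS, h1, h2⟩ := Measure.mutuallySingular_singularPart m (volume : Measure Torus)
    refine VectorMeasure.MutuallySingular.mk S hS (fun t ht htm => ?_) (fun t ht htm => ?_)
    · rw [Measure.toSignedMeasure_apply_measurable htm, measureReal_def,
        measure_mono_null ht h1, ENNReal.toReal_zero]
    · rw [Measure.toENNRealVectorMeasure_apply_measurable htm, measure_mono_null ht h2]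
  have heq : hh u = (m.singularPart volume).toSignedMeasure +
      (volume : Measure Torus).withDensityᵥ f := by
    rw [h.hh_eq]
    ext s hs
    rw [sub_apply, smul_apply, add_apply,
      Measure.toSignedMeasure_apply_measurable hs, Measure.toSignedMeasure_apply_measurable hs,
      Measure.toSignedMeasure_apply_measurable hs, withDensityᵥ_apply hfi hs, hf,
      integral_sub hρ.integrableOn (integrable_const _).integrableOn, setIntegral_const,
      Measure.setIntegral_toReal_rnDeriv_eq_withDensity' hs, smul_eq_mul, smul_eq_mul]
    have : m.real s = (m.singularPart volume).real s +
        ((volume : Measure Torus).withDensity (m.rnDeriv volume)).real s := by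
      rw [← measureReal_add_apply, Measure.singularPart_add_rnDeriv]
    rw [this]
    ring
  have := SignedMeasure.eq_rnDeriv _ f hfi hsing heq
  filter_upwards [this] with x hx
  rw [acDensity, ← hx, hf]
  simp only [sub_add_cancel, hm]

end IsShiftedSecondDeriv

theorem exists_isShiftedSecondDeriv {c₀ : ℝ} {u : USpace} (hu : u ∈ VTilde)
    (hp : PosMeasure c₀ u) : ∃ μ, IsShiftedSecondDeriv c₀ u μ := by
  have hp' := (VectorMeasure.le_restrict_univ_iff_le _ _).2 hp
  have h1 := SignedMeasure.toMeasureOfZeroLE_toSignedMeasure _ hp'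
  obtain ⟨m, hfin, hm⟩ : ∃ (m : Measure Torus) (_ : IsFiniteMeasure m),
      m.toSignedMeasure = hh u + c₀ • (volume : Measure Torus).toSignedMeasure :=
    ⟨_, SignedMeasure.toMeasureOfZeroLE_finite _ hp' MeasurableSet.univ, h1⟩
  let μ : FiniteMeasure Torus := ⟨m, hfin⟩
  refine ⟨μ, fun f hf => ?_⟩
  rw [hh_spec hu f hf, ← integral_shifted hf.continuous, eq_sub_of_add_eq hm.symm]
  rfl

/-- The functional `φ` on `U`, without the positivity constraint. -/
noncomputable def phiDensity (c₀ : ℝ) (w : USpace) : ℝ≥0∞ := ∫⁻ x, Phi (acDensity w x + c₀)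

/-- The effective domain of `φ + ψ`. -/
def energyDomain (c₀ C : ℝ) : Set USpace :=
  {w | w ∈ VTilde ∧ PosMeasure c₀ w ∧ normV w ≤ C ∧ phiDensity c₀ w ≠ ⊤}

/-- `φ + ψ` on its effective domain. -/
noncomputable def energyReal (c₀ : ℝ) (w : USpace) : ℝ := (phiDensity c₀ w).toReal

theorem energy_eq_coe {c₀ C : ℝ} {w : VTilde} (hw : (w : USpace) ∈ energyDomain c₀ C) :
    energy c₀ C w = (energyReal c₀ w : EReal) := by
  rw [energy, phi, psi, if_pos hw.2.1, if_pos hw.2.2.1, add_zero, energyReal]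
  exact (EReal.coe_ennreal_toReal hw.2.2.2).symm

theorem energy_eq_top {c₀ C : ℝ} {w : VTilde} (hw : (w : USpace) ∉ energyDomain c₀ C) :
    energy c₀ C w = ⊤ := by
  have : phi c₀ w + psi C w = ⊤ := by
    by_contra hne
    rw [ENNReal.add_eq_top, not_or] at hne
    obtain ⟨h1, h2⟩ := hne
    unfold phi at h1
    unfold psi at h2
    split_ifs at h1 h2 with h3 h4
    · exact hw ⟨w.2, h3, h4, h1⟩
    all_goals simp_all
  rw [energy, this]
  rfl

theorem phiDensity_le_iff {c₀ : ℝ} {u : USpace} {μ : FiniteMeasure Torus}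
    (h : IsShiftedSecondDeriv c₀ u μ) {K : ℝ} (hK : 0 ≤ K) :
    phiDensity c₀ u ≤ ENNReal.ofReal K ↔
      ∀ g : Torus → ℝ, Continuous g → (∀ x, 0 ≤ g x) →
        (∫ x, 3 / 2 * g x ^ 2) - ∫ x, g x ^ 3 ∂(μ : Measure Torus) ≤ K := by
  rw [← lintegral_Phi_le_iff (μ : Measure Torus) hK, phiDensity]
  rw [lintegral_congr_ae (h.acDensity_ae_eq.mono fun x hx => congrArg Phi hx)]

/-- The dual description of the sublevel sets of the energy. -/
theorem mem_sublevel_iff {c₀ C K : ℝ} (hK : 0 ≤ K) {u : USpace} :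
    u ∈ energyDomain c₀ C ∧ energyReal c₀ u ≤ K ↔
      ∃ μ : FiniteMeasure Torus, IsShiftedSecondDeriv c₀ u μ ∧
        (∀ f : Torus → ℝ, Continuous f → (∀ x, |f x| ≤ 1) →
          (∫ x, f x ∂(μ : Measure Torus)) - c₀ * ∫ x, f x ≤ C) ∧
        ∀ g : Torus → ℝ, Continuous g → (∀ x, 0 ≤ g x) →
          (∫ x, 3 / 2 * g x ^ 2) - ∫ x, g x ^ 3 ∂(μ : Measure Torus) ≤ K := by
  constructor
  · rintro ⟨⟨h1, h2, h3, h4⟩, h5⟩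
    obtain ⟨μ, hμ⟩ := exists_isShiftedSecondDeriv h1 h2
    refine ⟨μ, hμ, hμ.normV_le_iff.1 h3, (phiDensity_le_iff hμ hK).1 ?_⟩
    exact (ENNReal.le_ofReal_iff_toReal_le h4 hK).2 h5
  · rintro ⟨μ, hμ, h3, h4⟩
    have h5 := (phiDensity_le_iff hμ hK).2 h4
    have h6 : phiDensity c₀ u ≠ ⊤ := ne_top_of_le_ne_top ENNReal.ofReal_ne_top h5
    exact ⟨⟨hμ.mem_VTilde, hμ.posMeasure, hμ.normV_le_iff.2 h3, h6⟩,
      (ENNReal.le_ofReal_iff_toReal_le h6 hK).1 h5⟩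

theorem energyReal_nonneg (c₀ : ℝ) (u : USpace) : 0 ≤ energyReal c₀ u := ENNReal.toReal_nonneg

end Shift

end ThinFilm

/-! ### Closedness and convexity of the energy; B as a subdifferential in U. -/

namespace ThinFilm

section Energy

open Filter Topology
open scoped NNReal

theorem continuous_integral_mul_smooth {f : Torus → ℝ} (hf : SmoothOnTorus f) :
    Continuous fun u : USpace => ∫ x, (u : L2Torus) x * f x := by
  have : (fun u : USpace => ∫ x, (u : L2Torus) x * f x) =
      fun u : USpace => inner ℝ (u : L2Torus) (smoothToL2 ⟨⟨f, hf.continuous⟩, hf⟩) := by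
    funext u
    rw [inner_smoothToL2]
    rfl
  rw [this]
  fun_prop

theorem continuous_integral_finiteMeasure {f : Torus → ℝ} (hf : Continuous f) :
    Continuous fun μ : FiniteMeasure Torus => ∫ x, f x ∂(μ : Measure Torus) :=
  FiniteMeasure.continuous_integral_boundedContinuousFunction
    (BoundedContinuousFunction.mkOfCompact ⟨f, hf⟩)

/-- By the dual description the set is the projection to U of a closed set of pairs (u, μ). The
measures range over the weakly compact set of mass c₀, and projection along a compact factor is a
closed map. -/
theorem isClosed_sublevel {c₀ : ℝ} (hc₀ : 0 ≤ c₀) (C K : ℝ) :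
    IsClosed {u | u ∈ energyDomain c₀ C ∧ energyReal c₀ u ≤ K} := by
  rcases lt_or_ge K 0 with hK | hK
  · convert isClosed_empty
    ext u
    simp only [mem_ofPred_eq, mem_empty_iff_false, iff_false, not_and, not_le]
    exact fun _ => hK.trans_le (energyReal_nonneg c₀ u)
  let S : Set (FiniteMeasure Torus) := {μ | μ.mass = ⟨c₀, hc₀⟩}
  have hS : CompactSpace S := isCompact_iff_compactSpace.1
    (isCompact_setOfPred_finiteMeasure_eq_of_compactSpace Torus ⟨c₀, hc₀⟩)
  let Z : Set (USpace × S) := {p | IsShiftedSecondDeriv c₀ p.1 p.2 ∧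
        (∀ f : Torus → ℝ, Continuous f → (∀ x, |f x| ≤ 1) →
          (∫ x, f x ∂((p.2 : FiniteMeasure Torus) : Measure Torus)) - c₀ * ∫ x, f x ≤ C) ∧
        ∀ g : Torus → ℝ, Continuous g → (∀ x, 0 ≤ g x) →
          (∫ x, 3 / 2 * g x ^ 2) - ∫ x, g x ^ 3 ∂((p.2 : FiniteMeasure Torus) : Measure Torus) ≤ K}
  have hcm : ∀ f : Torus → ℝ, Continuous f →
      Continuous fun p : USpace × S => ∫ x, f x ∂((p.2 : FiniteMeasure Torus) : Measure Torus) :=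
    fun f hf => (continuous_integral_finiteMeasure hf).comp
      (continuous_subtype_val.comp continuous_snd)
  have hZ : IsClosed Z := by
    have h1 : IsClosed {p : USpace × S | IsShiftedSecondDeriv c₀ p.1 p.2} := by
      simp only [IsShiftedSecondDeriv, ofPred_forall]
      refine isClosed_iInter fun f => isClosed_iInter fun hf => isClosed_eq ?_ ?_
      · exact (continuous_integral_mul_smooth hf.dh.dh).comp continuous_fst
      · exact (hcm f hf.continuous).sub continuous_const
    have h2 : IsClosed {p : USpace × S | ∀ f : Torus → ℝ, Continuous f → (∀ x, |f x| ≤ 1) →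
        (∫ x, f x ∂((p.2 : FiniteMeasure Torus) : Measure Torus)) - c₀ * ∫ x, f x ≤ C} := by
      simp only [ofPred_forall]
      exact isClosed_iInter fun f => isClosed_iInter fun hf => isClosed_iInter fun _ =>
        isClosed_le ((hcm f hf).sub continuous_const) continuous_const
    have h3 : IsClosed {p : USpace × S | ∀ g : Torus → ℝ, Continuous g → (∀ x, 0 ≤ g x) →
        (∫ x, 3 / 2 * g x ^ 2) -
          ∫ x, g x ^ 3 ∂((p.2 : FiniteMeasure Torus) : Measure Torus) ≤ K} := by
      simp only [ofPred_forall]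
      exact isClosed_iInter fun g => isClosed_iInter fun hg => isClosed_iInter fun _ =>
        isClosed_le (continuous_const.sub (hcm (fun x => g x ^ 3) (hg.pow 3))) continuous_const
    exact h1.inter (h2.inter h3)
  have heq : {u | u ∈ energyDomain c₀ C ∧ energyReal c₀ u ≤ K} = Prod.fst '' Z := by
    ext u
    rw [mem_ofPred_eq, mem_sublevel_iff hK]
    constructor
    · rintro ⟨μ, hμ⟩
      have hm : μ.mass = ⟨c₀, hc₀⟩ := by
        ext
        exact hμ.1.measureReal_univ
      exact ⟨(u, ⟨μ, hm⟩), hμ, rfl⟩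
    · rintro ⟨⟨v, μ⟩, hμ, rfl⟩
      exact ⟨μ, hμ⟩
  rw [heq]
  exact isClosedMap_fst_of_compactSpace _ hZ

/-- Every condition of the dual description is affine in (u, μ), so the same combination of the two
measures certifies the combination of the points. -/
theorem convexOn_energyReal (c₀ C : ℝ) : ConvexOn ℝ (energyDomain c₀ C) (energyReal c₀) := by
  have key : ∀ u ∈ energyDomain c₀ C, ∀ v ∈ energyDomain c₀ C, ∀ a b : ℝ, 0 ≤ a → 0 ≤ b →
      a + b = 1 → a • u + b • v ∈ energyDomain c₀ C ∧
        energyReal c₀ (a • u + b • v) ≤ a * energyReal c₀ u + b * energyReal c₀ v := by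
    intro u hu v hv a b ha hb hab
    obtain ⟨μ, h1, h2, h3⟩ := (mem_sublevel_iff (energyReal_nonneg c₀ u)).1 ⟨hu, le_rfl⟩
    obtain ⟨ν, k1, k2, k3⟩ := (mem_sublevel_iff (energyReal_nonneg c₀ v)).1 ⟨hv, le_rfl⟩
    refine (mem_sublevel_iff (add_nonneg (mul_nonneg ha (energyReal_nonneg c₀ u))
      (mul_nonneg hb (energyReal_nonneg c₀ v)))).2 ?_
    lift a to ℝ≥0 using ha
    lift b to ℝ≥0 using hb
    have hint : ∀ f : Torus → ℝ, Continuous f →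
        ∫ x, f x ∂((a • μ + b • ν : FiniteMeasure Torus) : Measure Torus) =
          a * (∫ x, f x ∂(μ : Measure Torus)) + b * ∫ x, f x ∂(ν : Measure Torus) := by
      intro f hf
      rw [FiniteMeasure.toMeasure_add, FiniteMeasure.toMeasure_smul, FiniteMeasure.toMeasure_smul,
        integral_add_measure (integrable_of_continuous hf _) (integrable_of_continuous hf _),
        integral_smul_nnreal_measure, integral_smul_nnreal_measure]
      rfl
    refine ⟨a • μ + b • ν, fun f hf => ?_, fun f hf hf1 => ?_, fun g hg hg0 => ?_⟩
    · have e : ((((a : ℝ) • u + (b : ℝ) • v : USpace)) : L2Torus) =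
        (a : ℝ) • (u : L2Torus) + (b : ℝ) • (v : L2Torus) := rfl
      rw [hint f hf.continuous, e, integral_lp_add_mul hf.dh.dh, integral_lp_smul_mul,
        integral_lp_smul_mul, h1 f hf, k1 f hf]
      linear_combination (-c₀ * ∫ x, f x) * hab
    · rw [hint f hf]
      have e1 := mul_le_mul_of_nonneg_left (h2 f hf hf1) a.2
      have e2 := mul_le_mul_of_nonneg_left (k2 f hf hf1) b.2
      have e3 : (a : ℝ) * C + b * C = C := by rw [← add_mul, hab, one_mul]
      have e4 : c₀ * ∫ x, f x = (a : ℝ) * (c₀ * ∫ x, f x) + b * (c₀ * ∫ x, f x) := by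
        rw [← add_mul, hab, one_mul]
      change (a : ℝ) * _ ≤ a * _ at e1
      change (b : ℝ) * _ ≤ b * _ at e2
      linarith
    · rw [hint (fun x => g x ^ 3) (hg.pow 3)]
      have e1 := mul_le_mul_of_nonneg_left (h3 g hg hg0) a.2
      have e2 := mul_le_mul_of_nonneg_left (k3 g hg hg0) b.2
      have e4 : ∫ x, 3 / 2 * g x ^ 2 = (a : ℝ) * (∫ x, 3 / 2 * g x ^ 2) +
          b * ∫ x, 3 / 2 * g x ^ 2 := by
        rw [← add_mul, hab, one_mul]
      change (a : ℝ) * _ ≤ a * _ at e1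
      change (b : ℝ) * _ ≤ b * _ at e2
      linarith
  exact ⟨fun u hu v hv a b ha hb hab => (key u hu v hv a b ha hb hab).1,
    fun u hu v hv a b ha hb hab => (key u hu v hv a b ha hb hab).2⟩

/-- The measure c₀ times Lebesgue certifies 0, with energy bound Φ(c₀). This makes φ + ψ proper,
which `mem_B_iff` needs. -/
theorem zero_mem_energyDomain {c₀ C : ℝ} (hc₀ : 0 < c₀) (hC : 0 ≤ C) :
    (0 : USpace) ∈ energyDomain c₀ C := by
  have hK : 0 ≤ (c₀ ^ 2)⁻¹ / 2 := by positivity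
  refine ((mem_sublevel_iff hK).2 ?_).1
  let c : ℝ≥0 := ⟨c₀, hc₀.le⟩
  let μ : FiniteMeasure Torus := ⟨c • volume, inferInstance⟩
  have hint : ∀ f : Torus → ℝ, ∫ x, f x ∂(μ : Measure Torus) = c₀ * ∫ x, f x := fun f => by
    change ∫ x, f x ∂(c • (volume : Measure Torus)) = _
    rw [integral_smul_nnreal_measure]
    rfl
  refine ⟨μ, fun f hf => ?_, fun f _ _ => ?_, fun g hg hg0 => ?_⟩
  · rw [hint, sub_self]
    have h0 : ((0 : USpace) : L2Torus) = (0 : ℝ) • (0 : L2Torus) := by simp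
    rw [h0, integral_lp_smul_mul, zero_mul]
  · rw [hint, sub_self]; exact hC
  · have hi1 : Integrable (fun x => 3 / 2 * g x ^ 2) (volume : Measure Torus) :=
      integrable_of_continuous (continuous_const.mul (hg.pow 2)) _
    have hi2 : Integrable (fun x => c₀ * g x ^ 3) (volume : Measure Torus) :=
      integrable_of_continuous (continuous_const.mul (hg.pow 3)) _
    rw [hint, ← integral_const_mul, ← integral_sub hi1 hi2]
    calc ∫ x, (3 / 2 * g x ^ 2 - c₀ * g x ^ 3) ≤ ∫ _ : Torus, (c₀ ^ 2)⁻¹ / 2 := by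
          refine integral_mono (integrable_of_continuous (by fun_prop) _) (integrable_const _)
            fun x => ?_
          have h := ofReal_le_Phi (x := c₀) (hg0 x)
          rw [Phi, if_neg (not_le.2 hc₀), ENNReal.ofReal_le_ofReal_iff hK] at h
          simp only
          linarith
      _ = _ := by rw [integral_const, torus_measureReal_univ, one_smul]

/-- A point of infinite energy has no subgradient, as comparison with 0 shows, and outside the
effective domain the inequality is trivial. Boundedness on Ṽ is automatic by the Poincaré
inequality. -/
theorem mem_B_iff {c₀ C : ℝ} (hc₀ : 0 < c₀) (hC : 0 ≤ C) {w u : USpace} :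
    u ∈ B c₀ C w ↔ IsSubgradient (energyDomain c₀ C) (energyReal c₀) w u := by
  constructor
  · rintro ⟨hw, -, h⟩
    have hwD : w ∈ energyDomain c₀ C := by
      by_contra hne
      have h0 := h 0
      rw [energy_eq_top (w := ⟨w, hw⟩) hne,
        energy_eq_coe (w := 0) (zero_mem_energyDomain hc₀ hC), EReal.top_add_coe, top_le_iff] at h0
      exact EReal.coe_ne_top _ h0
    refine ⟨hwD, fun y hy => ?_⟩
    have h1 := h ⟨y, hy.1⟩
    rw [energy_eq_coe (w := ⟨w, hw⟩) hwD, energy_eq_coe (w := ⟨y, hy.1⟩) hy] at h1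
    exact_mod_cast h1
  · rintro ⟨hw, h⟩
    refine ⟨hw.1, ⟨4 * ‖u‖, fun v => ?_⟩, fun y => ?_⟩
    · refine (abs_real_inner_le_norm u (v : USpace)).trans ?_
      have := mul_le_mul_of_nonneg_left (norm_le_normV v.2) (norm_nonneg u)
      linarith
    · by_cases hy : (y : USpace) ∈ energyDomain c₀ C
      · rw [energy_eq_coe (w := ⟨w, hw.1⟩) hw, energy_eq_coe hy]
        have h1 := h y hy
        exact_mod_cast h1
      · rw [energy_eq_top hy]
        exact le_top

end Energy

end ThinFilm

/-! ### Regularity, positivity and uniqueness of curves. -/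

namespace ThinFilm

section Curves

open Filter Topology
open scoped NNReal

theorem secondCountableTopology_USpace : SecondCountableTopology USpace := by
  have h2 : Fact ((2 : ℝ≥0∞) ≠ ⊤) := ⟨by norm_num⟩
  have : SecondCountableTopology L2Torus := inferInstance
  exact TopologicalSpace.Subtype.secondCountableTopology (USpace : Set L2Torus)

/-- Continuous curves of mean-zero functions whose shifted second derivatives are positive measures
give weakly continuous curves of measures. -/
theorem continuous_shifted {X : Type*} [TopologicalSpace X] {c₀ : ℝ} {w : X → USpace}
    (hw : Continuous w) {μ : X → FiniteMeasure Torus}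
    (hμ : ∀ t, IsShiftedSecondDeriv c₀ (w t) (μ t)) : Continuous μ := by
  have hsmooth : ∀ f : Torus → ℝ, SmoothOnTorus f →
      Continuous fun t => ∫ x, f x ∂(μ t : Measure Torus) := fun f hf => by
    have h1 : (fun t => ∫ x, f x ∂(μ t : Measure Torus)) = fun t =>
        (∫ x, (w t : L2Torus) x * dh (dh f) x) + c₀ * ∫ x, f x := by
      funext t
      rw [hμ t f hf, sub_add_cancel]
    rw [h1]
    exact ((continuous_integral_mul_smooth hf.dh.dh).comp hw).add continuous_const
  rw [FiniteMeasure.continuous_iff_forall_continuous_integral]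
  intro f
  refine continuous_of_uniform_approx_of_continuous fun u hu => ?_
  obtain ⟨ε, hε, hεu⟩ := Metric.mem_uniformity_dist.1 hu
  -- All the measures have the same mass c₀, so a uniform approximation of f approximates the
  -- integrals uniformly in t.
  obtain ⟨g, hg, hgf⟩ := exists_smooth_near f.continuous (show 0 < ε / (|c₀| + 1) by positivity)
  refine ⟨_, hsmooth g hg, fun t => hεu ?_⟩
  have hsub : (∫ x, g x ∂(μ t : Measure Torus)) - ∫ x, f x ∂(μ t : Measure Torus) =
      ∫ x, (g x - f x) ∂(μ t : Measure Torus) :=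
    (integral_sub (integrable_of_continuous hg.continuous _)
      (integrable_of_continuous f.continuous _)).symm
  rw [dist_comm, Real.dist_eq, hsub]
  have h1 := norm_integral_le_of_norm_le_const (μ := (μ t : Measure Torus))
    (Eventually.of_forall fun x => (hgf x).le : ∀ᵐ x ∂(μ t : Measure Torus),
      ‖g x - f x‖ ≤ ε / (|c₀| + 1))
  rw [(hμ t).measureReal_univ] at h1
  refine h1.trans_lt ?_
  rw [div_mul_eq_mul_div, div_lt_iff₀ (by positivity)]
  nlinarith [le_abs_self c₀]

/-- Closed sets form a generating π-system, and the measure of a closed set is a limit of integrals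
of continuous functions, each continuous in t. This turns the curve into a kernel. -/
theorem measurable_toMeasure_of_continuous {X : Type*} [TopologicalSpace X] [MeasurableSpace X]
    [BorelSpace X] {μ : X → FiniteMeasure Torus} (hμ : Continuous μ) :
    Measurable fun t => (μ t : Measure Torus) := by
  have hc := FiniteMeasure.continuous_iff_forall_continuous_lintegral.1 hμ
  have hclosed : ∀ F : Set Torus, IsClosed F → Measurable fun t => (μ t : Measure Torus) F :=
    fun F hF => by
    refine measurable_of_tendsto_metrizable (f := fun n t => ∫⁻ x, hF.apprSeq n x ∂(μ t))
      (fun n => (hc _).measurable) ?_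
    rw [tendsto_pi_nhds]
    exact fun t => HasOuterApproxClosed.tendsto_lintegral_apprSeq hF (μ t : Measure Torus)
  refine Measurable.measure_of_isPiSystem (S := {F | IsClosed F}) ?_ isPiSystem_isClosed hclosed
    (hclosed univ isClosed_univ)
  rw [BorelSpace.measurable_eq (α := Torus), borel_eq_generateFrom_isClosed]

/-- Positivity properties of a continuous curve in the domain of the energy. -/
theorem isPositive_of_mem_energyDomain {c₀ C : ℝ} (T : ℝ) {w : ℝ → USpace} (hw : Continuous w)
    (hD : ∀ t, w t ∈ energyDomain c₀ C) : IsPositive c₀ T w := by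
  choose μ hμ using fun t => exists_isShiftedSecondDeriv (hD t).1 (hD t).2.1
  have hμm := measurable_toMeasure_of_continuous (continuous_shifted hw hμ)
  let κ : ProbabilityTheory.Kernel ℝ Torus := ⟨fun t => (μ t : Measure Torus), hμm⟩
  have hκ : ProbabilityTheory.IsFiniteKernel κ := by
    refine ⟨ENNReal.ofReal c₀, ENNReal.ofReal_lt_top, fun t => ?_⟩
    change (μ t : Measure Torus) univ ≤ _
    rw [← (hμ t).measureReal_univ, measureReal_def, ENNReal.ofReal_toReal (measure_ne_top _ _)]
  let vol : ProbabilityTheory.Kernel ℝ Torus := ProbabilityTheory.Kernel.const ℝ volume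
  -- The kernel derivative is jointly measurable in (t, x); densities chosen separately for each t
  -- need not be.
  let η : ℝ → Torus → ℝ := fun t x => (ProbabilityTheory.Kernel.rnDeriv κ vol t x).toReal - c₀
  have hηm : Measurable (Function.uncurry η) :=
    (ProbabilityTheory.Kernel.measurable_rnDeriv κ vol).ennreal_toReal.sub_const c₀
  have hηac : ∀ t, η t =ᵐ[(volume : Measure Torus)] acDensity (w t) := fun t => by
    have h1 : ProbabilityTheory.Kernel.rnDeriv κ vol t =ᵐ[(volume : Measure Torus)]
        (μ t : Measure Torus).rnDeriv volume :=
      ProbabilityTheory.Kernel.rnDeriv_eq_rnDeriv_measure (κ := κ) (η := vol) (a := t)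
    filter_upwards [h1, (hμ t).acDensity_ae_eq] with x hx1 hx2
    simp only [η]
    rw [hx1, ← hx2, add_sub_cancel_right]
  refine ⟨Eventually.of_forall fun t => (hD t).1, Eventually.of_forall fun t => (hD t).2.1,
    η, hηm.aestronglyMeasurable, Eventually.of_forall hηac, ?_⟩
  have hset : MeasurableSet {p : ℝ × Torus | 0 < η p.1 p.2 + c₀} :=
    measurableSet_lt measurable_const (hηm.add_const c₀)
  rw [Measure.ae_prod_iff_ae_ae hset]
  refine Eventually.of_forall fun t => ?_
  have hmeas : AEMeasurable (fun x => Phi (acDensity (w t) x + c₀)) (volume : Measure Torus) := by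
    have h1 : Measurable fun x => η t x + c₀ := (hηm.comp measurable_prodMk_left).add_const c₀
    refine (measurable_Phi.comp h1).aemeasurable.congr ?_
    filter_upwards [hηac t] with x hx
    simp only [Function.comp, hx]
  -- Finite energy makes Φ(η + c₀) finite almost everywhere, while Φ = +∞ on x ≤ 0.
  filter_upwards [ae_lt_top' hmeas (hD t).2.2.2, hηac t] with x hx1 hx2
  rw [hx2]
  by_contra hneg
  rw [Phi, if_pos (not_lt.1 hneg)] at hx1
  exact lt_irrefl _ hx1

theorem memLInfV_of_mem_energyDomain {c₀ C : ℝ} (T : ℝ) {w : ℝ → USpace} (hw : Continuous w)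
    (hD : ∀ t, w t ∈ energyDomain c₀ C) : MemLInfV T w := by
  choose μ hμ using fun t => exists_isShiftedSecondDeriv (hD t).1 (hD t).2.1
  refine ⟨Eventually.of_forall fun t => (hD t).1, ⟨C, Eventually.of_forall fun t => (hD t).2.2.1⟩,
    fun f => ?_⟩
  simp only [(hμ _).integral_hh f.continuous]
  exact (((continuous_integral_finiteMeasure f.continuous).comp
    (continuous_shifted hw hμ)).sub continuous_const).aemeasurable

/-- Curves in `W^{1,∞}` are Lipschitz and almost everywhere differentiable. -/
theorem MemW1Inf.lipschitz_and_hasDerivAt {T : ℝ} (hT : 0 < T) {w w' : ℝ → USpace}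
    (h : MemW1Inf T w w') : (∃ K : ℝ≥0, LipschitzOnWith K w (Icc 0 T)) ∧
      ∀ᵐ t, t ∈ Icc 0 T → HasDerivAt w (w' t) t := by
  obtain ⟨L, hL⟩ : ∃ L : ℝ≥0, ∀ᵐ x, x ∈ Icc 0 T → ‖w' x‖ ≤ L := by
    refine ⟨(eLpNormEssSup w' (volume.restrict (Icc 0 T))).toNNReal, ?_⟩
    rw [← ae_restrict_iff' measurableSet_Icc]
    have h1 : eLpNormEssSup w' (volume.restrict (Icc 0 T)) ≠ ⊤ := by
      have := h.memLp_deriv.2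
      rw [eLpNorm_exponent_top] at this
      exact this.ne
    filter_upwards [enorm_ae_le_eLpNormEssSup w' (volume.restrict (Icc 0 T))] with x hx
    have := ENNReal.toReal_mono h1 hx
    rwa [toReal_enorm] at this
  have hrep := eq_add_integral_of_weakDeriv hT h.continuousOn h.memLp_deriv.1 hL h.weak_deriv
  have hint := ae_restrict_Icc_of_bound hT.le h.memLp_deriv.1 hL
  have hu : uIcc 0 T = Icc 0 T := uIcc_of_le hT.le
  have hlip : LipschitzOnWith L (fun t => ∫ s in (0 : ℝ)..t, w' s) (uIcc 0 T) := by
    refine lipschitzOnWith_integral hint ?_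
    filter_upwards [hL] with x hx hx'
    rw [uIoc_of_le hT.le] at hx'
    exact hx (Ioc_subset_Icc_self hx')
  refine ⟨⟨L, LipschitzOnWith.of_dist_le_mul fun x hx y hy => ?_⟩, ?_⟩
  · rw [hrep x hx, hrep y hy, dist_add_left]
    exact hlip.dist_le_mul x (hu ▸ hx) y (hu ▸ hy)
  -- The integral formula holds only on [0, T], so a two-sided derivative is available only at
  -- interior times.
  · have h0 : ∀ᵐ t : ℝ, t ≠ 0 := by simp [ae_iff, measure_singleton]
    have h1 : ∀ᵐ t : ℝ, t ≠ T := by simp [ae_iff, measure_singleton]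
    filter_upwards [hint.ae_hasDerivAt_integral, h0, h1] with t ht ht0 htT hmem
    have h2 := (ht (hu ▸ hmem) 0 left_mem_uIcc).const_add (w 0)
    refine h2.congr_of_eventuallyEq ?_
    have h3 : Icc 0 T ∈ 𝓝 t := Icc_mem_nhds (lt_of_le_of_ne hmem.1 ht0.symm)
      (lt_of_le_of_ne hmem.2 htT)
    filter_upwards [h3] with s hs using hrep s hs

/-- The Cauchy problem has at most one strong solution. -/
theorem IsCauchySolution.eqOn {c₀ C T : ℝ} (hc₀ : 0 < c₀) (hC : 0 ≤ C) (hT : 0 < T)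
    {w₀ : USpace} {v v' w w' : ℝ → USpace} (hv : IsCauchySolution c₀ C T w₀ v v')
    (hw : IsCauchySolution c₀ C T w₀ w w') : EqOn v w (Icc 0 T) := by
  obtain ⟨⟨K, hK⟩, hdv⟩ := hv.memW1Inf.lipschitz_and_hasDerivAt hT
  obtain ⟨⟨L, hL⟩, hdw⟩ := hw.memW1Inf.lipschitz_and_hasDerivAt hT
  intro t ht
  refine sub_eq_zero.1 (eqOn_zero_of_inner_deriv_nonpos (d := fun t => v t - w t)
    (d' := fun t => v' t - w' t) (K := K + L) (T := T) ?_ ?_ ?_ ?_ t ht)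
  · exact hK.sub hL
  · filter_upwards [hdv, hdw] with x h1 h2 hx using (h1 hx).sub (h2 hx)
  · have h1 := (ae_restrict_iff' measurableSet_Icc).1 hv.inclusion
    have h2 := (ae_restrict_iff' measurableSet_Icc).1 hw.inclusion
    filter_upwards [h1, h2] with x h3 h4 hx
    have h5 := ((mem_B_iff hc₀ hC).1 (h3 hx)).monotone ((mem_B_iff hc₀ hC).1 (h4 hx))
    have h6 : -v' x - -w' x = -(v' x - w' x) := by abel
    rw [h6, inner_neg_left, real_inner_comm] at h5
    linarith
  · simp only [hv.initial, hw.initial, sub_self]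

end Curves

end ThinFilm

/-! ### Assembly of the main theorem. -/

theorem theorem2p3 (c₀ C T : ℝ) (hc₀ : 0 < c₀) (hC : 0 < C) (hT : 0 < T)
    (w₀ : ThinFilm.USpace) (hw₀ : w₀ ∈ ThinFilm.domB c₀ C) :
    ∃ w w' : ℝ → ThinFilm.USpace,
      ThinFilm.IsCauchySolution c₀ C T w₀ w w' ∧
      (∀ v v' : ℝ → ThinFilm.USpace, ThinFilm.IsCauchySolution c₀ C T w₀ v v' →
        Set.EqOn v w (Set.Icc 0 T)) ∧
      ThinFilm.IsVISolution c₀ C T w w' ∧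
      ThinFilm.IsPositive c₀ T w := by
  obtain ⟨ξ₀, hξ₀⟩ := hw₀
  have := ThinFilm.secondCountableTopology_USpace
  obtain ⟨w, hw0, hLip, hD, hevi⟩ := ThinFilm.exists_gradientFlow
    (ThinFilm.convexOn_energyReal c₀ C) (ThinFilm.isClosed_sublevel hc₀.le C)
    (fun x _ => ThinFilm.energyReal_nonneg c₀ x) ((ThinFilm.mem_B_iff hc₀ hC.le).1 hξ₀)
  have hcont := hLip.continuous
  have hdiff : ∀ᵐ t, HasDerivAt w (deriv w t) t :=
    hLip.ae_differentiableAt_hilbert.mono fun t ht => ht.hasDerivAt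
  have hderiv : ∀ t, ‖deriv w t‖ ≤ ‖ξ₀‖₊ := fun t => norm_deriv_le_of_lipschitz hLip
  have hm : AEStronglyMeasurable (deriv w) (volume.restrict (Icc 0 T)) :=
    (stronglyMeasurable_deriv w).aestronglyMeasurable
  have hW : ThinFilm.MemW1Inf T w (deriv w) := by
    refine ⟨hcont.continuousOn, ?_, ?_, fun θ h1 _ h3 => ?_⟩
    · obtain ⟨A, hA⟩ := isCompact_Icc.exists_bound_of_continuousOn (s := Icc 0 T) hcont.continuousOn
      exact memLp_top_of_bound hcont.aestronglyMeasurable A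
        ((ae_restrict_iff' measurableSet_Icc).2 (Filter.Eventually.of_forall hA))
    · exact memLp_top_of_bound hm _ (Filter.Eventually.of_forall hderiv)
    · exact ThinFilm.integral_deriv_smul_eq_neg hT.le hLip.lipschitzOnWith
        (hdiff.mono fun t ht _ => ht) hm (Filter.Eventually.of_forall fun t _ => hderiv t) h1 h3
  have hincl : ∀ᵐ t ∂(volume.restrict (Icc 0 T)), ThinFilm.IsSubgradient
      (ThinFilm.energyDomain c₀ C) (ThinFilm.energyReal c₀) (w t) (-deriv w t) := by
    rw [ae_restrict_iff' measurableSet_Icc]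
    have h0 : ∀ᵐ t : ℝ, t ≠ 0 := by simp [ae_iff, measure_singleton]
    filter_upwards [hdiff, h0] with t h1 h2 ht
    exact ThinFilm.isSubgradient_neg_deriv (lt_of_le_of_ne ht.1 h2.symm) (hD t)
      (fun v hv s hs hst => hevi v hv s t hs hst) h1
  have hsol : ThinFilm.IsCauchySolution c₀ C T w₀ w (deriv w) :=
    ⟨hW, hincl.mono fun t ht => (ThinFilm.mem_B_iff hc₀ hC.le).2 ht, hw0⟩
  refine ⟨w, deriv w, hsol, fun v v' hv => hv.eqOn hc₀ hC.le hT hsol, ⟨hW,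
    ThinFilm.memLInfV_of_mem_energyDomain T hcont hD, ?_⟩,
    ThinFilm.isPositive_of_mem_energyDomain T hcont hD⟩
  filter_upwards [hincl] with t ht
  refine ⟨ht.1.1, fun v => ?_⟩
  -- On the effective domain this is the subgradient inequality for -w_t rearranged; elsewhere the
  -- right-hand side is +∞.
  by_cases hv : (v : ThinFilm.USpace) ∈ ThinFilm.energyDomain c₀ C
  · rw [ThinFilm.energy_eq_coe (w := ⟨w t, ht.1.1⟩) ht.1, ThinFilm.energy_eq_coe hv]
    have h1 := ht.2 v hv
    rw [inner_neg_left] at h1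
    have h2 : ThinFilm.energyReal c₀ (w t) ≤
      inner ℝ (deriv w t) ((v : ThinFilm.USpace) - w t) + ThinFilm.energyReal c₀ v := by linarith
    exact_mod_cast h2
  · rw [ThinFilm.energy_eq_top hv, EReal.coe_add_top]
    exact le_top
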